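/- Let $F$ be a field of characteristic $0$, let $\mathcal Z=\langle z\rangle$ be infinite cyclic, $\mathcal Z_3=\langle a\rangle$ cyclic of order $3$, and $G=\mathcal Z\times\mathcal Z_3$. For any group $X$, a Schur ring over $X$ is a subspace $\mathcal A$ of $F[X]$ spanned by the elements $\overline C=\sum_{g\in C}g$, $C\in\mathcal D(\mathcal A)$, where $\mathcal D(\mathcal A)$ is a partition of $X$ into finite sets (the basic sets) such that $\{1\}\in\mathcal D(\mathcal A)$, $C^{-1}\in\mathcal D(\mathcal A)$ for every $C\in\mathcal D(\mathcal A)$, and $\overline C\cdot\overline E\in\mathcal A$ for all $C,E\in\mathcal D(\mathcal A)$. A subgroup that is a union of basic sets is called an $S$-subgroup. For a finite group $\mathcal K$ of automorphisms of $X$, the orbit Schur ring $F[X]^{\mathcal K}$ is the set of elements of $F[X]$ fixed by $\mathcal K$; $F[X]$ is the discrete Schur ring; for abelian $X$, $F[X]^{\pm}$ is the orbit Schur ring of the group generated by $g\mapsto g^{-1}$. $\mathcal A$ is a wedge product if there are $S$-subgroups $1<K\le H<X$ with $K$ normal in $X$ such that every basic set outside $H$ is a union of $K$-cosets. In that case we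 write $\mathcal A=\mathcal A_1\wedge\mathcal A_2$, where $\mathcal A_1=\mathcal A_H$ is the Schur ring over $H$ whose basic sets are those of $\mathcal A$ contained in $H$, and $\mathcal A_2=\mathcal A_{X/K}$ is the Schur ring over $X/K$ whose basic sets are the images of those of $\mathcal A$. $\mathcal A$ is traditional if it is the trivial Schur ring (with $X$ finite and basic sets $\{1\}$ and, if nonempty, $X\setminus\{1\}$), an orbit Schur ring, a tensor product of Schur rings over two proper subgroups $H,K$ with $X=H\times K$ (basic sets $CE$, with $C$ and $E$ basic sets of the factors), or a wedge product. A group is traditional if all Schur rings over it are. **Theorem.** Every Schur ring $\mathcal A$ over $G$ has one of the following forms, where in (i)–(iii) the wedge product is taken with normal $S$-subgroup $\mathcal Z_3$, and $G/\mathcal Z_3$ is identified with $\mathcal Z$: (i) $\mathcal A_1\wedge F[\mathcal Z]$ or $\mathcal A_1\wedge F[\mathcal Z]^{\pm}$ with $\mathcal A_1\in\{F[\mathcal Z_3],\,F[\mathcal Z_3]^{\pm}\}$; (ii) for some $1<H=\langle h\rangle<\mathcal Z$: $\mathcal A_1\wedge F[\mathcal Z]$ with $\mathcal A_1\in\{F[H\times\mathcal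 Z_3],\ F[H\times\mathcal Z_3]^{\langle\alpha\rangle}\}$, or $\mathcal A_1\wedge F[\mathcal Z]^{\pm}$ with $\mathcal A_1\in\{F[H\times\mathcal Z_3]^{\pm},\ F[H\times\mathcal Z_3]^{\langle\beta\rangle},\ F[H\times\mathcal Z_3]^{\langle\alpha,\beta\rangle}\}$, where $\alpha,\beta$ are the automorphisms of $H\times\mathcal Z_3$ with $\alpha:h\mapsto h,\ a\mapsto a^2$ and $\beta:h\mapsto h^{-1},\ a\mapsto a$; (iii) for some $1<K=\langle k\rangle<\mathcal Z$ and some $c\in\{a,a^2\}$: $F[K\times\mathcal Z_3]^{\langle\psi\rangle}\wedge F[\mathcal Z]$, or $\mathcal A_1\wedge F[\mathcal Z]^{\pm}$ with $\mathcal A_1\in\{F[K\times\mathcal Z_3]^{\langle\rho\rangle},\ F[K\times\mathcal Z_3]^{\langle\psi,\xi\rangle}\}$, where $\psi,\rho,\xi$ are the automorphisms of $K\times\mathcal Z_3$ with $\psi:k\mapsto ck,\ a\mapsto a^2$; $\rho:k\mapsto ck^{-1},\ a\mapsto a$; and $\xi:k\mapsto k^{-1},\ a\mapsto a^2$; (iv)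 $F[\mathcal Z\times\mathcal Z_3]$ or $F[\mathcal Z\times\mathcal Z_3]^{\pm}$; (v) an orbit Schur ring $F[G]^{\mathcal K}$ for some finite group $\mathcal K$ of automorphisms of $G$. Hence every Schur ring over $\mathcal Z\times\mathcal Z_3$ is an orbit Schur ring or a wedge product, and the group $\mathcal Z\times\mathcal Z_3$ is traditional. -/

import Mathlib

open scoped Pointwise

noncomputable section

/-- The simple quantity of a finite set `C` of group elements: the sum of its elements in the
group algebra `F[G]`. -/
def simpleQuantity (F : Type*) [Field F] {G : Type*} (C : Set G) : MonoidAlgebra F G :=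
  ∑ᶠ g ∈ C, MonoidAlgebra.single g (1 : F)

/-- A Schur ring over `G` with coefficients in `F`, given by its partition `D` of `G` into finite
basic sets. The Schur ring itself, as a subspace of `F[G]`, is `SchurRing.carrier`. -/
structure SchurRing (F : Type*) [Field F] (G : Type*) [Group G] where
  /-- the set of basic sets -/
  D : Set (Set G)
  isPartition : Setoid.IsPartition D
  finite_of_mem : ∀ C ∈ D, C.Finite
  one_mem : {1} ∈ D
  inv_mem : ∀ C ∈ D, C⁻¹ ∈ D
  mul_mem : ∀ C ∈ D, ∀ E ∈ D,
    simpleQuantity F C * simpleQuantity F E ∈ Submodule.span F (simpleQuantity F '' D)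

/-- The elements of `F[G]` fixed by a group `𝒦` of automorphisms of `G`. -/
def fixedElements (F : Type*) [Field F] {G : Type*} [Group G] (𝒦 : Subgroup (MulAut G)) :
    Submodule F (MonoidAlgebra F G) where
  carrier := {x | ∀ φ ∈ 𝒦, MonoidAlgebra.domCongr F F φ x = x}
  add_mem' := by
    intro x y hx hy φ hφ
    rw [map_add, hx φ hφ, hy φ hφ]
  zero_mem' := fun φ _ => map_zero _
  smul_mem' := by
    intro c x hx φ hφ
    rw [map_smul, hx φ hφ]

namespace SchurRing

variable {F : Type*} [Field F]

/-- The subspace of `F[G]` spanned by the simple quantities of the basic sets. -/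
def carrier {G : Type*} [Group G] (A : SchurRing F G) : Submodule F (MonoidAlgebra F G) :=
  Submodule.span F (simpleQuantity F '' A.D)

/-- `A = F[G]`, the discrete Schur ring. -/
def IsDiscrete {G : Type*} [Group G] (A : SchurRing F G) : Prop := A.carrier = ⊤

/-- `A = F[G]^𝒦`, the orbit Schur ring of a finite group `𝒦` of automorphisms of `G`. -/
def IsOrbit {G : Type*} [Group G] (A : SchurRing F G) (𝒦 : Subgroup (MulAut G)) : Prop :=
  Finite 𝒦 ∧ A.carrier = fixedElements F 𝒦

/-- `A = F[G]^±`, the symmetric Schur ring over an abelian group `G`: the elements of `F[G]` fixed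
by `g ↦ g⁻¹`. -/
def IsSymmetric {G : Type*} [CommGroup G] (A : SchurRing F G) : Prop :=
  A.IsOrbit (Subgroup.zpowers (MulEquiv.inv G))

/-- `A` is the trivial Schur ring over the finite group `G`, with basic sets `{1}` and `G \ {1}`
(the latter only if it is nonempty). -/
def IsTrivial {G : Type*} [Group G] (A : SchurRing F G) : Prop :=
  Finite G ∧ ∀ C : Set G, C ∈ A.D ↔ C = {1} ∨ (C = {1}ᶜ ∧ C.Nonempty)

/-- `A` is an orbit Schur ring. -/
def IsOrbitSchurRing {G : Type*} [Group G] (A : SchurRing F G) : Prop :=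
  ∃ 𝒦 : Subgroup (MulAut G), A.IsOrbit 𝒦

/-- `G` is the internal direct product of proper subgroups `H` and `K`, and `A` is the tensor
product of Schur rings over `H` and over `K`. -/
def IsTensorProduct {G : Type*} [Group G] (A : SchurRing F G) : Prop :=
  ∃ H K : Subgroup G, H ≠ ⊤ ∧ K ≠ ⊤ ∧ H.IsComplement' K ∧ (∀ h ∈ H, ∀ k ∈ K, Commute h k) ∧
    ∃ (B : SchurRing F H) (C : SchurRing F K),
      A.D = {X | ∃ Y ∈ B.D, ∃ Z ∈ C.D, X = (Subtype.val '' Y) * (Subtype.val '' Z)}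

/-- `H` is an `S`-subgroup of `A`: a subgroup that is a union of basic sets. -/
def IsSSubgroup {G : Type*} [Group G] (A : SchurRing F G) (H : Subgroup G) : Prop :=
  ∃ T ⊆ A.D, (H : Set G) = ⋃₀ T

/-- `1 < K ≤ H < G` is a wedge-decomposition of `A`: `H` and `K` are `S`-subgroups, `K` is normal
in `G`, and every basic set outside `H` is a union of `K`-cosets. -/
def IsWedgeDecomposition {G : Type*} [Group G] (A : SchurRing F G) (K H : Subgroup G) : Prop :=
  K ≠ ⊥ ∧ K ≤ H ∧ H ≠ ⊤ ∧ K.Normal ∧ A.IsSSubgroup K ∧ A.IsSSubgroup H ∧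
    ∀ C ∈ A.D, Disjoint C (H : Set G) → C * (K : Set G) = C

/-- `A` is a wedge product. -/
def IsWedgeProduct {G : Type*} [Group G] (A : SchurRing F G) : Prop :=
  ∃ K H : Subgroup G, A.IsWedgeDecomposition K H

/-- `A = A₁ ∧ A₂` with respect to the wedge-decomposition `1 < K ≤ H < G`, where
`A₁ = A_H` is the Schur ring over `H` whose basic sets are those of `A` contained in `H`, and
`A₂ = A_{G/K}` is the Schur ring over `G ⧸ K` whose basic sets are the images of those of `A`. -/
def IsWedge {G : Type*} [Group G] (A : SchurRing F G) (K H : Subgroup G) [K.Normal]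
    (A₁ : SchurRing F H) (A₂ : SchurRing F (G ⧸ K)) : Prop :=
  A.IsWedgeDecomposition K H ∧
    (∀ C : Set H, C ∈ A₁.D ↔ (Subtype.val '' C : Set G) ∈ A.D) ∧
    A₂.D = (fun C : Set G => (QuotientGroup.mk '' C : Set (G ⧸ K))) '' A.D

/-- `A` is traditional: trivial, an orbit Schur ring, a tensor product, or a wedge product. -/
def IsTraditional {G : Type*} [Group G] (A : SchurRing F G) : Prop :=
  A.IsTrivial ∨ A.IsOrbitSchurRing ∨ A.IsTensorProduct ∨ A.IsWedgeProduct

end SchurRing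

/-- The group `G` is traditional: every Schur ring over it is traditional. -/
def IsTraditionalGroup (F : Type*) [Field F] (G : Type*) [Group G] : Prop :=
  ∀ A : SchurRing F G, A.IsTraditional

/-- The infinite cyclic group, written multiplicatively. -/
abbrev Z : Type := Multiplicative ℤ

/-- The cyclic group of order three, written multiplicatively. -/
abbrev Z3 : Type := Multiplicative (ZMod 3)

/-- The generator of the cyclic group of order three. -/
def genA : Z3 := Multiplicative.ofAdd 1

/-- The subgroup `H × Z₃` of `Z × Z₃`. -/
abbrev timesZ3 (H : Subgroup Z) : Subgroup (Z × Z3) := H.prod ⊤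

/-- The subgroup `Z₃` of `Z × Z₃`. -/
abbrev subZ3 : Subgroup (Z × Z3) := timesZ3 ⊥

/-- For `H = ⟨h⟩`, the automorphism `φ` of `H × Z₃` is the one with `h ↦ x` and `a ↦ y`. -/
def IsAutWith (H : Subgroup Z) (φ : MulAut (timesZ3 H)) (h : Z) (x : Z × Z3) (y : Z3) : Prop :=
  H = Subgroup.zpowers h ∧
    (∀ u : timesZ3 H, (u : Z × Z3) = (h, 1) → (φ u : Z × Z3) = x) ∧
    ∀ u : timesZ3 H, (u : Z × Z3) = (1, genA) → (φ u : Z × Z3) = (1, y)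

end

/-!
In characteristic zero a Schur ring has natural numbers as structure constants, so its basic sets
also define a Schur ring over `ZMod p`, where the `p`-th power of `∑ g ∈ C, g` is
`∑ g ∈ C, g ^ p`. Hence injective power maps carry unions of basic sets to unions of basic sets.
It follows that the torsion subgroup `Z₃` of `Z × Z₃` is an `S`-subgroup and that the Schur rings
induced on `Z₃` and on `(Z × Z₃) / Z₃ ≅ Z` are discrete or symmetric.

If a coset of `Z₃` is not contained in a single basic set, it contains an element whose basic set is
`{x}` (discrete quotient), respectively an element whose basic set is `{x, x⁻¹}` (symmetric
quotient). The first coordinates of all such `x` form a subgroup `⟨h⟩` of `Z`, and every basic set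
outside `⟨h⟩ × Z₃` is a union of cosets of `Z₃`, so `A` is a wedge product over `⟨h⟩ × Z₃` unless
`⟨h⟩ = Z`. Choosing `x = (h, d)` as above, the isomorphism `Z × Z₃ ≃ ⟨h⟩ × Z₃` that sends `z` to `x`
and fixes `Z₃` turns the Schur ring induced on `⟨h⟩ × Z₃` into one over `Z × Z₃` in which the basic
set of `z` is `{z}` or `{z, z⁻¹}`; there are only five of those, all of them orbit Schur rings. The
automorphisms of forms (ii) and (iii) are the transports of `a ↦ a⁻¹` and `z ↦ z⁻¹`, for `d = 1`
and `d ≠ 1` respectively.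
-/

noncomputable section

/-! ### Basic sets of a Schur ring -/

section SimpleQuantity

variable {F : Type*} [Field F] {G : Type*}

open scoped Classical in
theorem coeff_simpleQuantity {C : Set G} (hC : C.Finite) (g : G) :
    (simpleQuantity F C).coeff g = if g ∈ C then 1 else 0 := by
  rw [simpleQuantity, finsum_mem_eq_finite_toFinset_sum _ hC, MonoidAlgebra.coeff_sum,
    Finsupp.finsetSum_apply]
  simp [Finsupp.single_apply]

theorem mem_span_simpleQuantity {D : Set (Set G)} (hD : Setoid.IsPartition D)
    (hfin : ∀ C ∈ D, C.Finite) {x : MonoidAlgebra F G}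
    (hx : ∀ C ∈ D, ∀ g ∈ C, ∀ h ∈ C, x.coeff g = x.coeff h) :
    x ∈ Submodule.span F (simpleQuantity F '' D) := by
  classical
  choose B hBD hB using fun g => (hD.2 g).exists
  have mem_iff (g u : G) : u ∈ B g ↔ B g = B u :=
    ⟨fun hu => (hD.2 u).unique ⟨hBD g, hu⟩ ⟨hBD u, hB u⟩, fun h => h ▸ hB u⟩
  have factors : Function.FactorsThrough x.coeff B := fun u v h =>
    hx _ (hBD v) u (h ▸ hB u) v (hB v)
  suffices x = ∑ C ∈ x.coeff.support.image B,
      Function.extend B x.coeff 0 C • simpleQuantity F C by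
    rw [this]
    refine Submodule.sum_mem _ fun C hC => Submodule.smul_mem _ _ (Submodule.subset_span ?_)
    obtain ⟨g, -, rfl⟩ := Finset.mem_image.1 hC
    exact ⟨_, hBD g, rfl⟩
  apply MonoidAlgebra.coeff_injective
  ext u
  have summand : ∀ C ∈ x.coeff.support.image B,
      (Function.extend B x.coeff 0 C • simpleQuantity F C).coeff u =
        if C = B u then x.coeff u else 0 := by
    intro C hC
    obtain ⟨g, -, rfl⟩ := Finset.mem_image.1 hC
    rw [MonoidAlgebra.coeff_smul_apply, coeff_simpleQuantity (hfin _ (hBD g)), mem_iff]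
    split_ifs with h
    · rw [h, factors.extend_apply, smul_eq_mul, mul_one]
    · exact smul_zero _
  rw [MonoidAlgebra.coeff_sum, Finsupp.finsetSum_apply, Finset.sum_congr rfl summand,
    Finset.sum_ite_eq']
  split_ifs with h
  · rfl
  · by_contra hu
    exact h (Finset.mem_image_of_mem B (Finsupp.mem_support_iff.2 hu))

theorem mem_span_simpleQuantity_iff {D : Set (Set G)} (hD : Setoid.IsPartition D)
    (hfin : ∀ C ∈ D, C.Finite) {x : MonoidAlgebra F G} :
    x ∈ Submodule.span F (simpleQuantity F '' D) ↔
      ∀ C ∈ D, ∀ g ∈ C, ∀ h ∈ C, x.coeff g = x.coeff h := by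
  classical
  refine ⟨fun hx C hC g hg h hh => ?_, mem_span_simpleQuantity hD hfin⟩
  induction hx using Submodule.span_induction with
  | mem y hy =>
    obtain ⟨E, hE, rfl⟩ := hy
    have mem_iff : g ∈ E ↔ h ∈ E :=
      ⟨fun hgE => (hD.2 g).unique ⟨hC, hg⟩ ⟨hE, hgE⟩ ▸ hh,
        fun hhE => (hD.2 h).unique ⟨hC, hh⟩ ⟨hE, hhE⟩ ▸ hg⟩
    simp only [coeff_simpleQuantity (hfin E hE), mem_iff]
  | zero => rfl
  | add y z _ _ hy hz => simp [hy, hz]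
  | smul c y _ hy => simp [hy]

/-- The number of factorizations `g = c * e` with `c ∈ C` and `e ∈ E`, which is the coefficient of
`g` in the product of the simple quantities of `C` and `E`. -/
def factorizationCount [Group G] (C E : Set G) (g : G) : ℕ := {c ∈ C | c⁻¹ * g ∈ E}.ncard

theorem coeff_simpleQuantity_mul [Group G] {C E : Set G} (hC : C.Finite) (hE : E.Finite) (g : G) :
    (simpleQuantity F C * simpleQuantity F E).coeff g = (factorizationCount C E g : F) := by
  classical
  have hsum : simpleQuantity F C = ∑ c ∈ hC.toFinset, MonoidAlgebra.single c (1 : F) :=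
    finsum_mem_eq_finite_toFinset_sum _ hC
  rw [hsum, Finset.sum_mul, MonoidAlgebra.coeff_sum, Finsupp.finsetSum_apply]
  simp only [MonoidAlgebra.coeff_single_mul_apply, one_mul, coeff_simpleQuantity hE]
  rw [Finset.sum_boole, ← Set.ncard_coe_finset, factorizationCount]
  congr 2
  ext c
  simp

theorem factorizationCount_pos_iff [Group G] {C E : Set G} (hC : C.Finite) {g : G} :
    0 < factorizationCount C E g ↔ g ∈ C * E := by
  rw [factorizationCount, Set.ncard_pos (hC.subset fun _ h => h.1)]
  constructor
  · rintro ⟨c, hc, he⟩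
    exact ⟨c, hc, _, he, mul_inv_cancel_left c g⟩
  · rintro ⟨c, hc, e, he, rfl⟩
    exact ⟨c, hc, by simpa using he⟩

theorem factorizationCount_image [Group G] {X : Type*} [Group X] {f : X →* G}
    (hf : Function.Injective f) (C E : Set X) (x : X) :
    factorizationCount (f '' C) (f '' E) (f x) = factorizationCount C E x := by
  have : {c ∈ f '' C | c⁻¹ * f x ∈ f '' E} = f '' {c ∈ C | c⁻¹ * x ∈ E} := by
    ext u
    constructor
    · rintro ⟨⟨c, hc, rfl⟩, hu⟩
      rw [← map_inv, ← map_mul, hf.mem_set_image] at hu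
      exact ⟨c, ⟨hc, hu⟩, rfl⟩
    · rintro ⟨c, ⟨hc, he⟩, rfl⟩
      exact ⟨⟨c, hc, rfl⟩, _, he, by simp⟩
  rw [factorizationCount, this, Set.ncard_image_of_injective _ hf, factorizationCount]

theorem factorizationCount_mul_subgroup [Group G] (K : Subgroup G) [K.Normal] (C E : Set G)
    (g : G) : factorizationCount (C * (K : Set G)) (E * (K : Set G)) g =
      Nat.card K * factorizationCount (QuotientGroup.mk '' C : Set (G ⧸ K))
        (QuotientGroup.mk '' E) (QuotientGroup.mk g) := by
  rw [factorizationCount, factorizationCount, ← Nat.card_coe_set_eq, ← Nat.card_coe_set_eq,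
    ← QuotientGroup.card_preimage_mk, ← QuotientGroup.preimage_image_mk_eq_mul,
    ← QuotientGroup.preimage_image_mk_eq_mul]
  rfl

end SimpleQuantity

namespace SchurRing

section Basic

variable {F : Type*} [Field F] {G : Type*} [Group G]

/-- The Schur ring with basic sets `D`, for a partition `D` whose structure constants do not depend
on the choice of an element of the product block. -/
def ofFactorizationCount (F : Type*) [Field F] (D : Set (Set G))
    (isPartition : Setoid.IsPartition D)
    (finite_of_mem : ∀ C ∈ D, C.Finite) (one_mem : {1} ∈ D) (inv_mem : ∀ C ∈ D, C⁻¹ ∈ D)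
    (count_eq : ∀ C ∈ D, ∀ E ∈ D, ∀ B ∈ D, ∀ g ∈ B, ∀ h ∈ B,
      factorizationCount C E g = factorizationCount C E h) : SchurRing F G where
  D := D
  isPartition := isPartition
  finite_of_mem := finite_of_mem
  one_mem := one_mem
  inv_mem := inv_mem
  mul_mem C hC E hE := by
    refine mem_span_simpleQuantity isPartition finite_of_mem fun B hB g hg h hh => ?_
    simp only [coeff_simpleQuantity_mul (finite_of_mem C hC) (finite_of_mem E hE),
      count_eq C hC E hE B hB g hg h hh]

variable (A : SchurRing F G)

/-- The basic set containing `g`. -/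
def block (g : G) : Set G := (A.isPartition.2 g).choose

theorem block_mem_D (g : G) : A.block g ∈ A.D := (A.isPartition.2 g).choose_spec.1.1

theorem mem_block (g : G) : g ∈ A.block g := (A.isPartition.2 g).choose_spec.1.2

theorem finite_block (g : G) : (A.block g).Finite := A.finite_of_mem _ (A.block_mem_D g)

variable {A}

theorem eq_block {C : Set G} (hC : C ∈ A.D) {g : G} (hg : g ∈ C) : C = A.block g :=
  (A.isPartition.2 g).unique ⟨hC, hg⟩ ⟨A.block_mem_D g, A.mem_block g⟩

theorem block_eq {g h : G} (hh : h ∈ A.block g) : A.block h = A.block g :=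
  (eq_block (A.block_mem_D g) hh).symm

theorem mem_block_symm {g h : G} (hh : h ∈ A.block g) : g ∈ A.block h :=
  block_eq hh ▸ A.mem_block g

theorem mem_D_iff {C : Set G} : C ∈ A.D ↔ ∃ g, C = A.block g := by
  refine ⟨fun hC => ?_, fun ⟨g, hg⟩ => hg ▸ A.block_mem_D g⟩
  obtain ⟨g, hg⟩ := Setoid.nonempty_of_mem_partition A.isPartition hC
  exact ⟨g, eq_block hC hg⟩

variable (A)

@[simp]
theorem block_one : A.block 1 = {1} := (eq_block A.one_mem rfl).symm

theorem block_inv (g : G) : A.block g⁻¹ = (A.block g)⁻¹ :=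
  (eq_block (A.inv_mem _ (A.block_mem_D g)) (Set.inv_mem_inv.2 (A.mem_block g))).symm

theorem mem_carrier_iff {x : MonoidAlgebra F G} :
    x ∈ A.carrier ↔ ∀ g, ∀ h ∈ A.block g, x.coeff h = x.coeff g := by
  rw [carrier, mem_span_simpleQuantity_iff A.isPartition A.finite_of_mem]
  constructor
  · exact fun hx g h hh => hx _ (A.block_mem_D g) h hh g (A.mem_block g)
  · intro hx C hC g hg h hh
    rw [eq_block hC hg] at hh
    exact (hx g h hh).symm

theorem one_mem_carrier : (1 : MonoidAlgebra F G) ∈ A.carrier := by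
  have : simpleQuantity F {(1 : G)} = 1 := by simp [simpleQuantity, MonoidAlgebra.one_def]
  exact this ▸ Submodule.subset_span ⟨_, A.one_mem, rfl⟩

variable {A}

theorem mul_mem_carrier {x y : MonoidAlgebra F G} (hx : x ∈ A.carrier) (hy : y ∈ A.carrier) :
    x * y ∈ A.carrier := by
  have : A.carrier * A.carrier ≤ A.carrier := by
    rw [carrier, Submodule.span_mul_span, Submodule.span_le]
    rintro _ ⟨_, ⟨C, hC, rfl⟩, _, ⟨E, hE, rfl⟩, rfl⟩
    exact A.mul_mem C hC E hE
  exact this (Submodule.mul_mem_mul hx hy)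

theorem pow_mem_carrier {x : MonoidAlgebra F G} (hx : x ∈ A.carrier) (n : ℕ) :
    x ^ n ∈ A.carrier := by
  induction n with
  | zero => simpa only [pow_zero] using A.one_mem_carrier
  | succ n ih => exact pow_succ x n ▸ mul_mem_carrier ih hx

variable (A) in
/-- A set is an `S`-set if it is a union of basic sets. -/
def IsSSet (S : Set G) : Prop := ∀ g ∈ S, A.block g ⊆ S

theorem isSSet_block (g : G) : A.IsSSet (A.block g) := fun _ hh => (block_eq hh).subset

theorem IsSSet.mem_iff {S : Set G} (hS : A.IsSSet S) {g h : G} (hh : h ∈ A.block g) :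
    h ∈ S ↔ g ∈ S :=
  ⟨fun h' => hS h h' (mem_block_symm hh), fun h' => hS g h' hh⟩

theorem IsSSet.diff {S T : Set G} (hS : A.IsSSet S) (hT : A.IsSSet T) : A.IsSSet (S \ T) :=
  fun g hg _ hh => ⟨hS g hg.1 hh, fun h' => hg.2 ((hT.mem_iff hh).1 h')⟩

theorem IsSSet.inv {S : Set G} (hS : A.IsSSet S) : A.IsSSet S⁻¹ := by
  intro g hg
  rw [← inv_inv g, block_inv, Set.inv_subset_inv]
  exact hS _ hg

theorem IsSSet.isSSubgroup {H : Subgroup G} (hH : A.IsSSet (H : Set G)) : A.IsSSubgroup H := by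
  refine ⟨{C ∈ A.D | C ⊆ H}, fun _ hC => hC.1, Set.Subset.antisymm (fun g hg => ?_) ?_⟩
  · exact ⟨A.block g, ⟨A.block_mem_D g, hH g hg⟩, A.mem_block g⟩
  · exact Set.sUnion_subset fun _ hC => hC.2

theorem isSSet_iff_simpleQuantity_mem {S : Set G} (hS : S.Finite) :
    A.IsSSet S ↔ simpleQuantity F S ∈ A.carrier := by
  classical
  simp only [mem_carrier_iff, coeff_simpleQuantity hS]
  refine ⟨fun h g u hu => by simp only [h.mem_iff hu], fun h g hg u hu => ?_⟩
  have := h g u hu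
  by_contra hn
  simp [hg, hn] at this

theorem factorizationCount_eq_of_mem_block [CharZero F] {S T : Set G} (hS : A.IsSSet S)
    (hT : A.IsSSet T) (hSf : S.Finite) (hTf : T.Finite) {g h : G} (hh : h ∈ A.block g) :
    factorizationCount S T h = factorizationCount S T g := by
  have := A.mem_carrier_iff.1 (mul_mem_carrier ((isSSet_iff_simpleQuantity_mem hSf).1 hS)
    ((isSSet_iff_simpleQuantity_mem hTf).1 hT)) g h hh
  rw [coeff_simpleQuantity_mul hSf hTf, coeff_simpleQuantity_mul hSf hTf] at this
  exact_mod_cast this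

theorem block_mul_subset [CharZero F] (g h : G) : A.block (g * h) ⊆ A.block g * A.block h := by
  intro u hu
  rw [← factorizationCount_pos_iff (A.finite_block g), factorizationCount_eq_of_mem_block
    (isSSet_block g) (isSSet_block h) (A.finite_block g) (A.finite_block h) hu,
    factorizationCount_pos_iff (A.finite_block g)]
  exact Set.mul_mem_mul (A.mem_block g) (A.mem_block h)

theorem IsSSet.mul [CharZero F] {S T : Set G} (hS : A.IsSSet S) (hT : A.IsSSet T) :
    A.IsSSet (S * T) := by
  rintro _ ⟨s, hs, t, ht, rfl⟩
  exact (block_mul_subset s t).trans (Set.mul_subset_mul (hS s hs) (hT t ht))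

end Basic

section Orbit

variable {F : Type*} [Field F] {G : Type*} [Group G]

theorem mem_fixedElements_iff {𝒦 : Subgroup (MulAut G)} {x : MonoidAlgebra F G} :
    x ∈ fixedElements F 𝒦 ↔ ∀ φ ∈ 𝒦, ∀ g, x.coeff (φ g) = x.coeff g := by
  constructor
  · intro h φ hφ g
    simpa using (congrArg (fun y => MonoidAlgebra.coeff y (φ g)) (h φ hφ)).symm
  · intro h φ hφ
    apply MonoidAlgebra.coeff_injective
    ext g
    rw [MonoidAlgebra.coeff_domCongr, ← h φ hφ (φ.symm g)]
    simp

variable {A : SchurRing F G}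

theorem isDiscrete_iff : A.IsDiscrete ↔ ∀ g, A.block g = {g} := by
  rw [IsDiscrete, eq_top_iff]
  constructor
  · intro h g
    have : A.IsSSet {g} := (isSSet_iff_simpleQuantity_mem (Set.finite_singleton g)).2 (h trivial)
    exact (this g rfl).antisymm (Set.singleton_subset_iff.2 (A.mem_block g))
  · intro h x _
    simp [mem_carrier_iff, h]

theorem isOrbit_iff {𝒦 : Subgroup (MulAut G)} :
    A.IsOrbit 𝒦 ↔ Finite 𝒦 ∧ ∀ g, A.block g = MulAction.orbit 𝒦 g := by
  classical
  refine and_congr_right fun _ => ⟨fun h g => Set.Subset.antisymm ?_ ?_, fun h => ?_⟩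
  · have hfin : (MulAction.orbit 𝒦 g).Finite := Set.finite_range _
    refine (isSSet_iff_simpleQuantity_mem hfin).2 ?_ g (MulAction.mem_orbit_self g)
    rw [h, mem_fixedElements_iff]
    intro φ hφ u
    have : φ u ∈ MulAction.orbit 𝒦 g ↔ u ∈ MulAction.orbit 𝒦 g := by
      rw [← MulAction.orbit_eq_iff, ← MulAction.orbit_eq_iff,
        ← MulAction.orbit_smul (⟨φ, hφ⟩ : 𝒦) u]
      rfl
    simp only [coeff_simpleQuantity hfin, this]
  · rintro _ ⟨⟨φ, hφ⟩, rfl⟩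
    have := (isSSet_iff_simpleQuantity_mem (A.finite_block g)).1 (isSSet_block g)
    rw [h, mem_fixedElements_iff] at this
    by_contra hn
    change φ g ∉ _ at hn
    have := this φ hφ g
    rw [coeff_simpleQuantity (A.finite_block g), coeff_simpleQuantity (A.finite_block g),
      if_neg hn, if_pos (A.mem_block g)] at this
    exact zero_ne_one this
  · ext x
    simp only [mem_carrier_iff, mem_fixedElements_iff, h, MulAction.mem_orbit_iff]
    exact ⟨fun hx φ hφ g => hx g _ ⟨⟨φ, hφ⟩, rfl⟩, fun hx g _ ⟨φ, hφ⟩ => hφ ▸ hx φ.1 φ.2 g⟩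

theorem isOrbit_closure [Group.FG G] {S : Set (MulAut G)}
    (apply_mem : ∀ φ ∈ S, ∀ g, φ g ∈ A.block g)
    (exists_apply_eq : ∀ g, ∀ u ∈ A.block g, ∃ φ ∈ Subgroup.closure S, φ g = u) :
    A.IsOrbit (Subgroup.closure S) := by
  have apply_mem_block : ∀ φ ∈ Subgroup.closure S, ∀ g, φ g ∈ A.block g := by
    intro φ hφ
    induction hφ using Subgroup.closure_induction with
    | mem φ hφ => exact apply_mem φ hφ
    | one => exact fun g => A.mem_block g
    | mul φ ψ _ _ hφ hψ => exact fun g => block_eq (hψ g) ▸ hφ (ψ g)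
    | inv φ _ hφ =>
      intro g
      simpa only [MulAut.apply_inv_self] using mem_block_symm (hφ (φ⁻¹ g))
  have finite_closure : Finite (Subgroup.closure S) := by
    obtain ⟨T, hT⟩ := Group.FG.out (G := G)
    have (t : T) : Finite (A.block t) := A.finite_block t
    refine Finite.of_injective
      (fun (φ : Subgroup.closure S) (t : T) =>
        (⟨φ.1 t, apply_mem_block φ.1 φ.2 t⟩ : A.block t)) fun φ ψ hφψ => ?_
    refine Subtype.ext (MulEquiv.toMonoidHom_injective (MonoidHom.eq_of_eqOn_dense hT ?_))
    exact fun t ht => congrArg Subtype.val (congrFun hφψ ⟨t, ht⟩)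
  refine isOrbit_iff.2 ⟨finite_closure, fun g => Set.Subset.antisymm (fun u hu => ?_) ?_⟩
  · obtain ⟨φ, hφ, rfl⟩ := exists_apply_eq g u hu
    exact ⟨⟨φ, hφ⟩, rfl⟩
  · rintro _ ⟨φ, rfl⟩
    exact apply_mem_block φ.1 φ.2 g

theorem IsDiscrete.isOrbitSchurRing (h : A.IsDiscrete) : A.IsOrbitSchurRing := by
  refine ⟨⊥, isOrbit_iff.2 ⟨inferInstance, fun g => ?_⟩⟩
  rw [isDiscrete_iff.1 h]
  ext u
  simp [MulAction.mem_orbit_iff, eq_comm]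

theorem isSymmetric_iff {G : Type*} [CommGroup G] {A : SchurRing F G} :
    A.IsSymmetric ↔ ∀ g, A.block g = {g, g⁻¹} := by
  have inv_sq : (MulEquiv.inv G : MulAut G) ^ 2 = 1 := by
    ext g
    simp [pow_two]
  have hfin : Finite (Subgroup.zpowers (MulEquiv.inv G : MulAut G)) :=
    (isOfFinOrder_iff_pow_eq_one.2 ⟨2, two_pos, inv_sq⟩).finite_zpowers
  have mem_zpowers_iff (φ : MulAut G) :
      φ ∈ Subgroup.zpowers (MulEquiv.inv G : MulAut G) ↔ φ = 1 ∨ φ = MulEquiv.inv G := by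
    refine ⟨?_, by rintro (rfl | rfl) <;> simp⟩
    rintro ⟨n, rfl⟩
    have inv_zpow_two : (MulEquiv.inv G : MulAut G) ^ (2 : ℤ) = 1 := mod_cast inv_sq
    rcases n.even_or_odd' with ⟨k, rfl | rfl⟩ <;> simp [zpow_mul, zpow_add, inv_zpow_two]
  have orbit_eq (g : G) :
      MulAction.orbit (Subgroup.zpowers (MulEquiv.inv G : MulAut G)) g = {g, g⁻¹} := by
    ext u
    simp only [MulAction.mem_orbit_iff, Subtype.exists, Subgroup.smul_def, mem_zpowers_iff,
      MulAut.smul_def, exists_prop, exists_eq_or_imp, exists_eq_left, MulAut.one_apply,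
      MulEquiv.inv_apply, Set.mem_insert_iff, Set.mem_singleton_iff, eq_comm]
  simp only [IsSymmetric, isOrbit_iff, hfin, orbit_eq, true_and]

variable (A) in
/-- The thin elements of a Schur ring are those whose basic set is a singleton; they form a
subgroup. -/
def thin [CharZero F] : Subgroup G where
  carrier := {g | A.block g = {g}}
  one_mem' := A.block_one
  mul_mem' {g h} (hg : A.block g = {g}) (hh : A.block h = {h}) := by
    have := block_mul_subset (A := A) g h
    rw [hg, hh, Set.singleton_mul_singleton] at this
    exact this.antisymm (Set.singleton_subset_iff.2 (A.mem_block _))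
  inv_mem' {g} (hg : A.block g = {g}) := by
    change A.block g⁻¹ = {g⁻¹}
    rw [block_inv, hg, Set.inv_singleton]

theorem mem_thin_iff [CharZero F] {g : G} : g ∈ A.thin ↔ A.block g = {g} := Iff.rfl

theorem block_mul_of_mem_thin [CharZero F] {g : G} (hg : g ∈ A.thin) (h : G) :
    A.block (g * h) = {g} * A.block h := by
  have subset {g : G} (hg : g ∈ A.thin) (h : G) : A.block (g * h) ⊆ {g} * A.block h :=
    mem_thin_iff.1 hg ▸ block_mul_subset g h
  refine (subset hg h).antisymm ?_
  have := Set.mul_subset_mul_left (s := {g}) (subset (A.thin.inv_mem hg) (g * h))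
  rwa [inv_mul_cancel_left, ← mul_assoc, Set.singleton_mul_singleton, mul_inv_cancel,
    Set.singleton_one, one_mul] at this

end Orbit

section Power

variable {F : Type*} [Field F] [CharZero F]

/-- The Schur ring with the same basic sets over another field. -/
def changeField {G : Type*} [Group G] (A : SchurRing F G) (K : Type*) [Field K] : SchurRing K G :=
  ofFactorizationCount K A.D A.isPartition A.finite_of_mem A.one_mem A.inv_mem <| by
    intro C hC E hE B hB g hg h hh
    obtain ⟨c, rfl⟩ := mem_D_iff.1 hC
    obtain ⟨e, rfl⟩ := mem_D_iff.1 hE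
    exact factorizationCount_eq_of_mem_block (isSSet_block c) (isSSet_block e) (A.finite_block c)
      (A.finite_block e) (eq_block hB hh ▸ hg)

variable {G : Type*} [CommGroup G] {A : SchurRing F G} {S : Set G}

-- Over `ZMod p`, the `p`-th power of the simple quantity of `S` is that of `{g ^ p | g ∈ S}`.
theorem IsSSet.image_pow_prime (hS : A.IsSSet S) (hSf : S.Finite) {p : ℕ} (hp : p.Prime)
    (hinj : Function.Injective fun g : G => g ^ p) : A.IsSSet ((fun g : G => g ^ p) '' S) := by
  classical
  have := Fact.mk hp
  have : CharP (MonoidAlgebra (ZMod p) G) p :=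
    charP_of_injective_algebraMap (algebraMap (ZMod p) (MonoidAlgebra (ZMod p) G)).injective p
  have frobenius : simpleQuantity (ZMod p) ((fun g : G => g ^ p) '' S) =
      simpleQuantity (ZMod p) S ^ p := by
    rw [simpleQuantity, simpleQuantity, finsum_mem_image hinj.injOn,
      finsum_mem_eq_finite_toFinset_sum _ hSf, finsum_mem_eq_finite_toFinset_sum _ hSf,
      sum_pow_char]
    simp [MonoidAlgebra.single_pow]
  have isSSet_iff (T : Set G) : A.IsSSet T ↔ (A.changeField (ZMod p)).IsSSet T := Iff.rfl
  rw [isSSet_iff, isSSet_iff_simpleQuantity_mem (hSf.image _), frobenius]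
  rw [isSSet_iff, isSSet_iff_simpleQuantity_mem hSf] at hS
  exact pow_mem_carrier hS p

theorem IsSSet.image_pow (hS : A.IsSSet S) (hSf : S.Finite) {n : ℕ}
    (hinj : Function.Injective fun g : G => g ^ n) : A.IsSSet ((fun g : G => g ^ n) '' S) := by
  induction n using Nat.recOnMul generalizing S with
  | zero =>
    have : Subsingleton G := ⟨fun g h => hinj (by simp)⟩
    exact fun g hg u _ => Subsingleton.elim g u ▸ hg
  | one => simpa using hS
  | prime p hp => exact hS.image_pow_prime hSf hp hinj
  | mul a b iha ihb =>
    have ha : Function.Injective fun g : G => g ^ a :=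
      .of_comp (f := fun g => g ^ b) (by simpa [Function.comp_def, pow_mul] using hinj)
    have hb : Function.Injective fun g : G => g ^ b :=
      .of_comp (f := fun g => g ^ a) (by simpa [Function.comp_def, pow_mul'] using hinj)
    simpa [Set.image_image, pow_mul] using ihb (iha hS hSf ha) (hSf.image _) hb

theorem IsSSet.image_zpow (hS : A.IsSSet S) (hSf : S.Finite) {n : ℤ}
    (hinj : Function.Injective fun g : G => g ^ n) : A.IsSSet ((fun g : G => g ^ n) '' S) := by
  obtain ⟨n, rfl | rfl⟩ := n.eq_nat_or_neg
  · simpa using hS.image_pow hSf (by simpa using hinj)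
  · simpa [Set.image_image, ← Set.image_inv_eq_inv] using
      (hS.image_pow hSf (n := n) (by simpa [Function.Injective] using hinj)).inv

theorem exists_prime_injective_pow [Finite (CommGroup.torsion G)] {g : G}
    (hg : g ∈ CommGroup.torsion G) :
    ∃ p : ℕ, p.Prime ∧ (Function.Injective fun h : G => h ^ p) ∧ g ^ p = g := by
  obtain ⟨p, hp, hlt, hmod⟩ := Nat.exists_prime_gt_modEq_one (k := orderOf g)
    (Nat.card (CommGroup.torsion G)) (IsOfFinOrder.orderOf_pos hg).ne'
  refine ⟨p, hp, ?_, ?_⟩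
  · refine (injective_iff_map_eq_one (powMonoidHom p : G →* G)).2 fun h (hh : h ^ p = 1) => ?_
    rcases hp.eq_one_or_self_of_dvd _ (orderOf_dvd_of_pow_eq_one hh) with h1 | h1
    · exact orderOf_eq_one_iff.1 h1
    · have hmem : h ∈ CommGroup.torsion G := isOfFinOrder_iff_pow_eq_one.2 ⟨p, hp.pos, hh⟩
      have := orderOf_le_card (x := (⟨h, hmem⟩ : CommGroup.torsion G))
      rw [Subgroup.orderOf_mk, h1] at this
      exact absurd this hlt.not_ge
  · conv_rhs => rw [← pow_one g]
    exact pow_eq_pow_iff_modEq.2 hmod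

theorem isSSet_torsion [Finite (CommGroup.torsion G)] :
    A.IsSSet (CommGroup.torsion G : Set G) := by
  intro g hg u hu
  obtain ⟨p, hp, hinj, hgp⟩ := exists_prime_injective_pow hg
  have image_block : (fun h : G => h ^ p) '' A.block g = A.block g := by
    refine (Set.eq_of_subset_of_ncard_le ?_ ?_ ((A.finite_block g).image _)).symm
    · exact (isSSet_block g).image_pow (A.finite_block g) hinj g ⟨g, A.mem_block g, hgp⟩
    · rw [Set.ncard_image_of_injective _ hinj]
  have pow_mem (k : ℕ) : u ^ p ^ k ∈ A.block g := by
    induction k with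
    | zero => simpa using hu
    | succ k ih =>
      rw [pow_succ, pow_mul, ← image_block]
      exact ⟨_, ih, rfl⟩
  by_contra hu'
  refine Set.infinite_of_injective_forall_mem (f := fun k => u ^ p ^ k) ?_ pow_mem
    (A.finite_block g)
  exact (injective_pow_iff_not_isOfFinOrder.2 hu').comp (Nat.pow_right_injective hp.two_le)

end Power

section Cyclic

variable {F : Type*} [Field F] [CharZero F] {G : Type*} [CommGroup G] {A : SchurRing F G}

theorem isDiscrete_or_isSymmetric_of_block_subset (eq_one_of_inv_eq : ∀ g : G, g⁻¹ = g → g = 1)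
    (block_subset : ∀ g, A.block g ⊆ {g, g⁻¹}) : A.IsDiscrete ∨ A.IsSymmetric := by
  have block_eq_pair {g : G} (hg : g ∉ A.thin) : A.block g = {g, g⁻¹} := by
    refine (block_subset g).antisymm (Set.pair_subset (A.mem_block g) ?_)
    by_contra hinv
    refine hg (Set.Subset.antisymm (fun u hu => ?_) (by simpa using A.mem_block g))
    exact (block_subset g hu).resolve_right fun h => hinv (h ▸ hu)
  rw [or_iff_not_imp_left, isDiscrete_iff, isSymmetric_iff]
  intro h
  obtain ⟨h, hh⟩ := not_forall.1 h
  intro g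
  by_cases hg : g ∈ A.thin
  · have hmem : g * h⁻¹ ∈ A.block (g * h) := by
      rw [block_mul_of_mem_thin hg, block_eq_pair hh]
      exact Set.mul_mem_mul rfl (by simp)
    rcases block_subset _ hmem with heq | heq
    · rw [eq_one_of_inv_eq h (mul_left_cancel heq)] at hh
      exact absurd A.block_one hh
    · rw [Set.mem_singleton_iff, mul_inv, mul_right_cancel_iff, eq_comm] at heq
      simp [eq_one_of_inv_eq g heq]
  · exact block_eq_pair hg

theorem block_zpow_subset [IsMulTorsionFree G] (g : G) (n : ℤ) :
    A.block (g ^ n) ⊆ (fun h => h ^ n) '' A.block g := by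
  obtain rfl | hn := eq_or_ne n 0
  · simpa using ⟨g, A.mem_block g⟩
  · exact (isSSet_block g).image_zpow (A.finite_block g) (zpow_left_injective hn) _
      ⟨g, A.mem_block g, rfl⟩

theorem block_generator_subset [IsMulTorsionFree G] {z : G} (hz : ∀ g, g ∈ Subgroup.zpowers z) :
    A.block z ⊆ {z, z⁻¹} := by
  intro u hu
  obtain ⟨k, rfl⟩ := hz u
  obtain rfl | hz1 := eq_or_ne z 1
  · simp
  obtain ⟨v, -, hv⟩ := block_zpow_subset z k (mem_block_symm hu)
  obtain ⟨m, rfl⟩ := hz v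
  have hkm : k * m = 1 := by
    refine injective_zpow_iff_not_isOfFinOrder.2 (mt (isOfFinOrder_iff_eq_one z).1 hz1) ?_
    simpa [← zpow_mul', mul_comm] using hv
  rcases Int.eq_one_or_neg_one_of_mul_eq_one hkm with rfl | rfl <;> simp

theorem isDiscrete_or_isSymmetric [IsCyclic G] [IsMulTorsionFree G] (A : SchurRing F G) :
    A.IsDiscrete ∨ A.IsSymmetric := by
  obtain ⟨z, hz⟩ := IsCyclic.exists_generator (α := G)
  refine isDiscrete_or_isSymmetric_of_block_subset (fun g => inv_eq_self.1) fun g => ?_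
  obtain ⟨n, rfl⟩ := hz g
  refine (block_zpow_subset z n).trans ?_
  rintro _ ⟨v, hv, rfl⟩
  rcases block_generator_subset hz hv with rfl | rfl <;> simp

end Cyclic

section Comap

variable {F : Type*} [Field F] [CharZero F] {G : Type*} [Group G] {X : Type*} [Group X]

/-- The Schur ring induced on `X` by a Schur ring over `G`, along an injective homomorphism whose
range is an `S`-subgroup. -/
def comap (A : SchurRing F G) (f : X →* G) (hf : Function.Injective f)
    (hr : A.IsSSet (f.range : Set G)) : SchurRing F X := by
  refine ofFactorizationCount F {C : Set X | f '' C ∈ A.D}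
    ⟨fun h => A.isPartition.1 (by simpa using h), fun x => ?_⟩
    (fun C hC => (A.finite_of_mem _ hC).of_finite_image hf.injOn) (by simpa using A.one_mem)
    (fun C hC => ?_) fun C hC E hE B hB g hg h hh => ?_
  · refine ⟨f ⁻¹' A.block (f x), ⟨?_, A.mem_block (f x)⟩, fun C ⟨hC, hx⟩ => ?_⟩
    · change f '' _ ∈ A.D
      rw [Set.image_preimage_eq_of_subset (hr (f x) ⟨x, rfl⟩)]
      exact A.block_mem_D _
    · rw [← eq_block hC ⟨x, hx, rfl⟩, Set.preimage_image_eq _ hf]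
  · change f '' C⁻¹ ∈ A.D
    rw [Set.image_inv]
    exact A.inv_mem _ hC
  · obtain ⟨c, hc⟩ := mem_D_iff.1 hC
    obtain ⟨e, he⟩ := mem_D_iff.1 hE
    rw [← factorizationCount_image hf, ← factorizationCount_image hf, hc, he]
    refine factorizationCount_eq_of_mem_block (isSSet_block c) (isSSet_block e) (A.finite_block c)
      (A.finite_block e) ?_
    rw [← eq_block hB ⟨h, hh, rfl⟩]
    exact ⟨g, hg, rfl⟩

theorem image_block_comap {A : SchurRing F G} {f : X →* G} (hf : Function.Injective f)
    (hr : A.IsSSet (f.range : Set G)) (x : X) :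
    f '' (A.comap f hf hr).block x = A.block (f x) :=
  eq_block (A := A) ((A.comap f hf hr).block_mem_D x) ⟨x, mem_block _ x, rfl⟩

/-- The Schur ring `A_H` induced on an `S`-subgroup `H`. -/
def restrict (A : SchurRing F G) (H : Subgroup G) (hH : A.IsSSet (H : Set G)) : SchurRing F H :=
  A.comap H.subtype H.subtype_injective (H.range_subtype.symm ▸ hH)

theorem image_block_restrict {A : SchurRing F G} {H : Subgroup G} (hH : A.IsSSet (H : Set G))
    (x : H) : Subtype.val '' (A.restrict H hH).block x = A.block x :=
  image_block_comap H.subtype_injective _ x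

end Comap

section CayleyIso

variable {F : Type*} [Field F]

/-- The isomorphism `e` of groups is a Cayley isomorphism from `A` to `B`: it maps the basic sets
of `A` to those of `B`. -/
def IsCayleyIso {X Y : Type*} [Group X] [Group Y] (e : X ≃* Y) (A : SchurRing F X)
    (B : SchurRing F Y) : Prop :=
  ∀ x, e '' A.block x = B.block (e x)

variable {X Y : Type*} [Group X] [Group Y] {e : X ≃* Y} {A : SchurRing F X} {B : SchurRing F Y}

theorem IsCayleyIso.isDiscrete (he : IsCayleyIso e A B) (hA : A.IsDiscrete) : B.IsDiscrete := by
  rw [isDiscrete_iff] at hA ⊢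
  refine e.surjective.forall.2 fun x => ?_
  rw [← he, hA, Set.image_singleton]

theorem IsCayleyIso.isOrbit (he : IsCayleyIso e A B) {𝒦 : Subgroup (MulAut X)}
    (hA : A.IsOrbit 𝒦) : B.IsOrbit (𝒦.map (MulAut.congr e).toMonoidHom) := by
  rw [isOrbit_iff] at hA ⊢
  obtain ⟨_, hA⟩ := hA
  refine ⟨.of_surjective _ (MonoidHom.subgroupMap_surjective _ 𝒦),
    e.surjective.forall.2 fun x => ?_⟩
  rw [← he, hA]
  have congr_apply (φ : MulAut X) : MulAut.congr e φ (e x) = e (φ x) :=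
    congrArg (fun x => e (φ x)) (e.symm_apply_apply x)
  refine Set.Subset.antisymm ?_ ?_
  · rintro _ ⟨_, ⟨φ, rfl⟩, rfl⟩
    exact ⟨⟨_, Subgroup.mem_map_of_mem _ φ.2⟩, congr_apply φ⟩
  · rintro _ ⟨⟨_, φ, hφ, rfl⟩, rfl⟩
    exact ⟨_, ⟨⟨φ, hφ⟩, rfl⟩, (congr_apply φ).symm⟩

theorem IsCayleyIso.isSymmetric {X Y : Type*} [CommGroup X] [CommGroup Y] {e : X ≃* Y}
    {A : SchurRing F X} {B : SchurRing F Y} (he : IsCayleyIso e A B) (hA : A.IsSymmetric) :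
    B.IsSymmetric := by
  rw [isSymmetric_iff] at hA ⊢
  refine e.surjective.forall.2 fun x => ?_
  rw [← he, hA, Set.image_pair, map_inv]

end CayleyIso

section Quotient

variable {F : Type*} [Field F] [CharZero F] {G : Type*} [Group G] {A : SchurRing F G}
  {K : Subgroup G}

theorem image_mk_block_eq (hK : A.IsSSet (K : Set G)) {g h : G}
    (hh : (h : G ⧸ K) ∈ (QuotientGroup.mk '' A.block g : Set (G ⧸ K))) :
    (QuotientGroup.mk '' A.block h : Set (G ⧸ K)) = QuotientGroup.mk '' A.block g := by
  have subset {g h : G} (hh : (h : G ⧸ K) ∈ (QuotientGroup.mk '' A.block g : Set (G ⧸ K))) :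
      (QuotientGroup.mk '' A.block h : Set (G ⧸ K)) ⊆ QuotientGroup.mk '' A.block g := by
    rw [Set.image_subset_iff, QuotientGroup.preimage_image_mk_eq_mul]
    refine (isSSet_block g).mul hK h ?_
    rwa [← QuotientGroup.preimage_image_mk_eq_mul]
  refine (subset hh).antisymm ?_
  obtain ⟨x, hx, hxh⟩ := hh
  rw [← block_eq hx]
  exact subset ⟨h, A.mem_block h, hxh.symm⟩

variable [K.Normal] [Finite K]

variable (A K) in
/-- The Schur ring `A_{G/K}` over the quotient by a finite normal `S`-subgroup `K`. -/
def quotient (hK : A.IsSSet (K : Set G)) : SchurRing F (G ⧸ K) := by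
  refine ofFactorizationCount F ((fun C : Set G => (QuotientGroup.mk '' C : Set (G ⧸ K))) '' A.D)
    ⟨?_, fun q => ?_⟩ ?_ ⟨{1}, A.one_mem, by simp⟩ ?_ ?_
  · rintro ⟨C, hC, h⟩
    exact A.isPartition.1 (Set.image_eq_empty.1 h ▸ hC)
  · obtain ⟨g, rfl⟩ := QuotientGroup.mk_surjective q
    refine ⟨_, ⟨⟨_, A.block_mem_D g, rfl⟩, g, A.mem_block g, rfl⟩, ?_⟩
    rintro _ ⟨⟨C, hC, rfl⟩, hg⟩
    obtain ⟨h, rfl⟩ := mem_D_iff.1 hC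
    exact (image_mk_block_eq hK hg).symm
  · rintro _ ⟨C, hC, rfl⟩
    exact (A.finite_of_mem C hC).image _
  · rintro _ ⟨C, hC, rfl⟩
    exact ⟨C⁻¹, A.inv_mem C hC, Set.image_inv (QuotientGroup.mk' K) C⟩
  · rintro _ ⟨C, hC, rfl⟩ _ ⟨E, hE, rfl⟩ _ ⟨B, hB, rfl⟩ _ ⟨g, hg, rfl⟩ _ ⟨h, hh, rfl⟩
    obtain ⟨c, rfl⟩ := mem_D_iff.1 hC
    obtain ⟨e, rfl⟩ := mem_D_iff.1 hE
    refine Nat.eq_of_mul_eq_mul_left (Nat.card_pos (α := K)) ?_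
    rw [← factorizationCount_mul_subgroup, ← factorizationCount_mul_subgroup]
    exact factorizationCount_eq_of_mem_block ((isSSet_block c).mul hK) ((isSSet_block e).mul hK)
      ((A.finite_block c).mul (Set.toFinite _)) ((A.finite_block e).mul (Set.toFinite _))
      (eq_block hB hh ▸ hg)

theorem block_quotient (hK : A.IsSSet (K : Set G)) (g : G) :
    (A.quotient K hK).block (g : G ⧸ K) = QuotientGroup.mk '' A.block g :=
  (eq_block (A := A.quotient K hK) ⟨_, A.block_mem_D g, rfl⟩ ⟨g, A.mem_block g, rfl⟩).symm

theorem isWedge_restrict_quotient {H : Subgroup G} (hK : A.IsSSet (K : Set G))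
    (hH : A.IsSSet (H : Set G)) (hK1 : K ≠ ⊥) (hKH : K ≤ H) (hH1 : H ≠ ⊤)
    (mul_mem_block : ∀ g ∉ H, ∀ k ∈ K, g * k ∈ A.block g) :
    A.IsWedge K H (A.restrict H hH) (A.quotient K hK) := by
  refine ⟨⟨hK1, hKH, hH1, inferInstance, hK.isSSubgroup, hH.isSSubgroup, fun C hC hdisj => ?_⟩,
    fun _ => Iff.rfl, rfl⟩
  refine Set.Subset.antisymm ?_ fun g hg => ⟨g, hg, 1, K.one_mem, mul_one g⟩
  rintro _ ⟨g, hg, k, hk, rfl⟩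
  rw [eq_block hC hg]
  exact mul_mem_block g (Set.disjoint_left.1 hdisj hg) k hk

end Quotient

end SchurRing

/-! ### The Schur rings induced on `Z₃` and `(Z × Z₃) / Z₃` -/

theorem Z3.eq_or_eq_inv {b c : Z3} (hb : b ≠ 1) (hc : c ≠ 1) : c = b ∨ c = b⁻¹ := by
  revert b c; decide

theorem mem_subZ3_iff {g : Z × Z3} : g ∈ subZ3 ↔ g.1 = 1 := by
  simp [Subgroup.mem_prod]

instance : Finite subZ3 :=
  .of_injective (fun t => t.1.2) fun t s h =>
    Subtype.ext (Prod.ext ((mem_subZ3_iff.1 t.2).trans (mem_subZ3_iff.1 s.2).symm) h)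

theorem torsion_eq_subZ3 : CommGroup.torsion (Z × Z3) = subZ3 := by
  rw [CommGroup.torsion_prod, CommGroup.isMulTorsionFree_iff_torsion_eq_bot.1 inferInstance,
    CommGroup.torsion_eq_top_iff.2 isMulTorsion_of_finite]

theorem eq_one_of_inv_eq {g : Z × Z3} (h : g⁻¹ = g) : g = 1 := by
  have snd_eq_one : ∀ b : Z3, b⁻¹ = b → b = 1 := by decide
  exact Prod.ext (inv_eq_self.1 (congrArg Prod.fst h)) (snd_eq_one _ (congrArg Prod.snd h))

theorem mk_subZ3_eq_iff {g h : Z × Z3} :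
    (g : (Z × Z3) ⧸ subZ3) = h ↔ g.1 = h.1 := by
  rw [QuotientGroup.eq, mem_subZ3_iff, Prod.fst_mul, Prod.fst_inv, inv_mul_eq_one]

/-- The quotient of `Z × Z₃` by `Z₃` is identified with `Z` by the first projection. -/
def quotientSubZ3Equiv : (Z × Z3) ⧸ subZ3 ≃* Z :=
  (QuotientGroup.quotientMulEquivOfEq (by ext; simp [mem_subZ3_iff])).trans
    (QuotientGroup.quotientKerEquivOfSurjective (MonoidHom.fst Z Z3) Prod.fst_surjective)

theorem quotientSubZ3Equiv_mk (g : Z × Z3) : quotientSubZ3Equiv (g : (Z × Z3) ⧸ subZ3) = g.1 :=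
  rfl

namespace SchurRing

variable {F : Type*} [Field F] [CharZero F]

section Fiber

variable {G Q : Type*} [Group G] [Group Q] {A : SchurRing F G}

theorem injOn_block_of_fiber {π : G →* Q} (hker : A.IsSSet (π.ker : Set G)) {x : G}
    (hx : ∀ u ∈ A.block x, π u = π x → u = x) : Set.InjOn π (A.block x) := by
  intro u hu v hv huv
  by_contra hne
  have hS : A.IsSSet ((π.ker : Set G) \ {1}) := hker.diff (A.block_one ▸ isSSet_block 1)
  have hmem : v ∈ A.block x * ((π.ker : Set G) \ {1}) := by
    refine ⟨u, hu, u⁻¹ * v, ⟨?_, ?_⟩, mul_inv_cancel_left u v⟩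
    · simp [MonoidHom.mem_ker, huv]
    · simpa [inv_mul_eq_one] using hne
  have hsub := ((isSSet_block x).mul hS) v hmem (mem_block_symm hv)
  obtain ⟨y, hy, s, ⟨hs, hs1⟩, hys⟩ := hsub
  have : y = x := hx y hy (by simp [← hys, MonoidHom.mem_ker.1 hs])
  subst this
  exact hs1 (by simpa using hys)

end Fiber

variable (A : SchurRing F (Z × Z3))

theorem isSSet_subZ3 : A.IsSSet (subZ3 : Set (Z × Z3)) := by
  have : Finite (CommGroup.torsion (Z × Z3)) := torsion_eq_subZ3 ▸ inferInstance
  exact torsion_eq_subZ3 ▸ isSSet_torsion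

/-- The Schur ring induced on the torsion subgroup `Z₃` of `Z × Z₃`. -/
abbrev restrictZ3 : SchurRing F subZ3 := A.restrict subZ3 A.isSSet_subZ3

/-- The Schur ring induced on `(Z × Z₃) / Z₃`. -/
abbrev quotientZ3 : SchurRing F ((Z × Z3) ⧸ subZ3) := A.quotient subZ3 A.isSSet_subZ3

theorem quotientZ3_isDiscrete_or_isSymmetric :
    A.quotientZ3.IsDiscrete ∨ A.quotientZ3.IsSymmetric := by
  have : IsCyclic ((Z × Z3) ⧸ subZ3) :=
    isCyclic_of_surjective quotientSubZ3Equiv.symm quotientSubZ3Equiv.symm.surjective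
  have : IsMulTorsionFree ((Z × Z3) ⧸ subZ3) :=
    quotientSubZ3Equiv.injective.isMulTorsionFree quotientSubZ3Equiv.toMonoidHom
  exact isDiscrete_or_isSymmetric _

variable {A}

theorem fst_eq_of_mem_block (hQ : A.quotientZ3.IsDiscrete) {g u : Z × Z3} (hu : u ∈ A.block g) :
    u.1 = g.1 := by
  have := Set.mem_image_of_mem (QuotientGroup.mk (s := subZ3)) hu
  rw [← block_quotient A.isSSet_subZ3, isDiscrete_iff.1 hQ] at this
  exact mk_subZ3_eq_iff.1 this

theorem image_fst_block (hQ : A.quotientZ3.IsSymmetric) (g : Z × Z3) :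
    Prod.fst '' A.block g = {g.1, g.1⁻¹} := by
  have hg := block_quotient A.isSSet_subZ3 g
  rw [isSymmetric_iff.1 hQ] at hg
  have := congrArg (quotientSubZ3Equiv '' ·) hg
  simpa only [Set.image_pair, Set.image_image, map_inv, quotientSubZ3Equiv_mk, eq_comm] using this

theorem isSSet_timesZ3 (H : Subgroup Z) : A.IsSSet (timesZ3 H : Set (Z × Z3)) := by
  rintro g ⟨hg, -⟩ u hu
  refine ⟨?_, trivial⟩
  rcases A.quotientZ3_isDiscrete_or_isSymmetric with hQ | hQ
  · exact (fst_eq_of_mem_block hQ hu).symm ▸ hg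
  · rcases image_fst_block hQ g ▸ Set.mem_image_of_mem Prod.fst hu with h | h
    · exact h ▸ hg
    · exact h ▸ H.inv_mem hg

variable (A) in
theorem restrictZ3_isDiscrete_or_isSymmetric :
    A.restrictZ3.IsDiscrete ∨ A.restrictZ3.IsSymmetric := by
  refine isDiscrete_or_isSymmetric_of_block_subset (fun g hg => ?_) fun g u hu => ?_
  · exact Subtype.ext (eq_one_of_inv_eq (congrArg Subtype.val hg))
  · obtain rfl | hg := eq_or_ne g 1
    · simpa using hu
    have hu1 : u ≠ 1 := by
      rintro rfl
      exact hg (by simpa using mem_block_symm hu)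
    have snd_ne_one {t : subZ3} (ht : t ≠ 1) : t.1.2 ≠ 1 := fun h =>
      ht (Subtype.ext (Prod.ext (mem_subZ3_iff.1 t.2) h))
    have fst_eq (t s : subZ3) : t.1.1 = s.1.1 :=
      (mem_subZ3_iff.1 t.2).trans (mem_subZ3_iff.1 s.2).symm
    exact (Z3.eq_or_eq_inv (snd_ne_one hg) (snd_ne_one hu1)).imp
      (fun h => Subtype.ext (Prod.ext (fst_eq u g) h))
      (fun h => Subtype.ext (Prod.ext (fst_eq u g⁻¹) h))

theorem block_eq_singleton_of_restrictZ3 (hK : A.restrictZ3.IsDiscrete) {t : Z × Z3}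
    (ht : t.1 = 1) : A.block t = {t} := by
  rw [← image_block_restrict A.isSSet_subZ3 ⟨t, mem_subZ3_iff.2 ht⟩, isDiscrete_iff.1 hK,
    Set.image_singleton]

theorem block_eq_pair_of_restrictZ3 (hK : A.restrictZ3.IsSymmetric) {t : Z × Z3}
    (ht : t.1 = 1) : A.block t = {t, t⁻¹} := by
  rw [← image_block_restrict A.isSSet_subZ3 ⟨t, mem_subZ3_iff.2 ht⟩, isSymmetric_iff.1 hK,
    Set.image_pair]
  rfl

end SchurRing

/-! ### Cosets of `Z₃` -/

theorem Z3.eq_or_eq_or_eq {b c d e : Z3} (hcb : c ≠ b) (hdb : d ≠ b) (hdc : d ≠ c) :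
    e = b ∨ e = c ∨ e = d := by
  revert b c d e; decide

theorem Z3.mul_self (b : Z3) : b * b = b⁻¹ := by
  revert b; decide

theorem inv_eq_mul_self {t : Z × Z3} (ht : t.1 = 1) : t⁻¹ = t * t :=
  Prod.ext (by simp [ht]) (Z3.mul_self t.2).symm

theorem exists_zpowers_eq (H : Subgroup Z) : ∃ h, Subgroup.zpowers h = H :=
  H.isCyclic_iff_exists_zpowers_eq_top.1 inferInstance

namespace SchurRing

variable {F : Type*} [Field F] {A : SchurRing F (Z × Z3)}

/-- The basic set of `x` meets the coset of `Z₃` through `x` only in `x`. -/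
def IsTransversal (A : SchurRing F (Z × Z3)) (x : Z × Z3) : Prop :=
  ∀ u ∈ A.block x, u.1 = x.1 → u = x

/-- Every basic set that contains an element outside `H × Z₃` is a union of cosets of `Z₃`; this is
the condition on basic sets in a wedge-decomposition `1 < Z₃ ≤ H × Z₃`. -/
def IsFullOutside (A : SchurRing F (Z × Z3)) (H : Subgroup Z) : Prop :=
  ∀ g : Z × Z3, g.1 ∉ H → ∀ u : Z × Z3, u.1 = g.1 → u ∈ A.block g

/-- The basic set of `x` is `{x, x⁻¹}`. -/
def IsInvPair (A : SchurRing F (Z × Z3)) (x : Z × Z3) : Prop :=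
  A.block x = {x, x⁻¹}

theorem exists_isTransversal {g y : Z × Z3} (hy : y.1 = g.1) (hyg : y ∉ A.block g) :
    ∃ x, x.1 = g.1 ∧ A.IsTransversal x := by
  by_cases hw : ∃ w ∈ A.block g, w.1 = g.1 ∧ w ≠ g
  · obtain ⟨w, hwg, hw1, hne⟩ := hw
    refine ⟨y, hy, fun u hu hu1 => ?_⟩
    have snd_ne {p q : Z × Z3} (h1 : p.1 = q.1) (h : p ≠ q) : p.2 ≠ q.2 :=
      fun h2 => h (Prod.ext h1 h2)
    have eq_of_snd {p : Z × Z3} (hp : p.1 = g.1) (h : u.2 = p.2) : u = p :=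
      Prod.ext (hu1.trans (hy.trans hp.symm)) h
    rcases Z3.eq_or_eq_or_eq (e := u.2) (snd_ne hw1 hne)
      (snd_ne hy fun h => hyg (h ▸ A.mem_block g))
      (snd_ne (hy.trans hw1.symm) fun h => hyg (h ▸ hwg)) with h | h | h
    · exact absurd (mem_block_symm (eq_of_snd rfl h ▸ hu)) hyg
    · exact absurd (block_eq hwg ▸ mem_block_symm (eq_of_snd hw1 h ▸ hu)) hyg
    · exact eq_of_snd hy h
  · push Not at hw
    exact ⟨g, rfl, hw⟩

theorem isFullOutside_of_isTransversal {H : Subgroup Z} (hH : ∀ x, A.IsTransversal x → x.1 ∈ H) :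
    A.IsFullOutside H := by
  intro g hg u hu
  by_contra hug
  obtain ⟨x, hx, hxt⟩ := exists_isTransversal hu hug
  exact hg (hx ▸ hH x hxt)

theorem isInvPair_one : A.IsInvPair 1 := by
  simp [IsInvPair]

theorem IsInvPair.inv {x : Z × Z3} (hx : A.IsInvPair x) : A.IsInvPair x⁻¹ := by
  rw [IsInvPair, block_inv, hx, Set.inv_insert, Set.inv_singleton]

variable [CharZero F]

theorem IsTransversal.mem_thin (hQ : A.quotientZ3.IsDiscrete) {x : Z × Z3}
    (hx : A.IsTransversal x) : x ∈ A.thin :=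
  Set.Subset.antisymm (fun u hu => hx u hu (fst_eq_of_mem_block hQ hu))
    (Set.singleton_subset_iff.2 (A.mem_block x))

theorem exists_mem_thin_isFullOutside (hQ : A.quotientZ3.IsDiscrete) :
    ∃ x ∈ A.thin, A.IsFullOutside (Subgroup.zpowers x.1) := by
  obtain ⟨h, hh⟩ := exists_zpowers_eq (A.thin.map (MonoidHom.fst Z Z3))
  obtain ⟨x, hx, rfl⟩ : h ∈ A.thin.map (MonoidHom.fst Z Z3) := hh ▸ Subgroup.mem_zpowers h
  refine ⟨x, hx, isFullOutside_of_isTransversal fun y hy => ?_⟩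
  exact (congrArg (y.1 ∈ ·) hh).mpr ⟨y, hy.mem_thin hQ, rfl⟩

theorem exists_mem_block_fst_eq_inv (hQ : A.quotientZ3.IsSymmetric) (x : Z × Z3) :
    ∃ y ∈ A.block x, y.1 = x.1⁻¹ :=
  (image_fst_block hQ x ▸ Set.mem_insert_of_mem _ rfl : x.1⁻¹ ∈ Prod.fst '' A.block x)

theorem fst_eq_or_eq_inv (hQ : A.quotientZ3.IsSymmetric) {x u : Z × Z3} (hu : u ∈ A.block x) :
    u.1 = x.1 ∨ u.1 = x.1⁻¹ :=
  (image_fst_block hQ x ▸ Set.mem_image_of_mem Prod.fst hu : u.1 ∈ ({x.1, x.1⁻¹} : Set Z))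

theorem isInvPair_of_block_subset (hQ : A.quotientZ3.IsSymmetric) {x : Z × Z3} (hx1 : x.1 ≠ 1)
    (hx : A.block x ⊆ {x, x⁻¹}) : A.IsInvPair x := by
  refine hx.antisymm (Set.pair_subset (A.mem_block x) ?_)
  obtain ⟨y, hy, hy1⟩ := exists_mem_block_fst_eq_inv hQ x
  obtain rfl | rfl := hx hy
  · exact absurd (self_eq_inv.1 hy1) hx1
  · exact hy

theorem IsInvPair.mul (hQ : A.quotientZ3.IsSymmetric) {x y : Z × Z3} (hx : A.IsInvPair x)
    (hy : A.IsInvPair y) (hx1 : x.1 ≠ 1) (hy1 : y.1 ≠ 1) (hxy1 : (x * y).1 ≠ 1) :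
    A.IsInvPair (x * y) := by
  refine isInvPair_of_block_subset hQ hxy1 fun u hu => ?_
  have mixed_ne {a b : Z} (ha : a ≠ 1) (hb : b ≠ 1) :
      ¬(a * b⁻¹ = a * b ∨ a * b⁻¹ = (a * b)⁻¹) := by
    rw [mul_right_inj, mul_inv, mul_left_inj, inv_eq_self, self_eq_inv]
    exact not_or_intro hb ha
  have fst_mem := fst_eq_or_eq_inv hQ hu
  obtain ⟨p, hp, q, hq, rfl⟩ := block_mul_subset x y hu
  rw [hx] at hp
  rw [hy] at hq
  obtain hp | hp := hp <;> obtain hq | hq := hq <;> rw [hp, hq] at fst_mem ⊢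
  · exact .inl rfl
  · exact absurd fst_mem (mixed_ne hx1 hy1)
  · exact (mixed_ne hy1 hx1 (by simpa [mul_comm] using fst_mem)).elim
  · exact .inr (mul_inv x y).symm

theorem block_eq_pair_of_isTransversal (hQ : A.quotientZ3.IsSymmetric) {x y : Z × Z3}
    (hx : A.IsTransversal x) (hy : y ∈ A.block x) (hy1 : y.1 = x.1⁻¹) : A.block x = {x, y} := by
  have hker : A.IsSSet ((MonoidHom.fst Z Z3).ker : Set (Z × Z3)) := by
    convert A.isSSet_subZ3
    ext
    simp [mem_subZ3_iff]
  refine Set.Subset.antisymm (fun u hu => ?_) (Set.pair_subset (A.mem_block x) hy)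
  exact (fst_eq_or_eq_inv hQ hu).imp (hx u hu) fun h =>
    injOn_block_of_fiber (π := MonoidHom.fst Z Z3) hker hx hu hy (h.trans hy1.symm)

theorem IsTransversal.isInvPair (hQ : A.quotientZ3.IsSymmetric) (hK : A.restrictZ3.IsSymmetric)
    {x : Z × Z3} (hx1 : x.1 ≠ 1) (hx : A.IsTransversal x) : A.IsInvPair x := by
  obtain ⟨y, hy, hy1⟩ := exists_mem_block_fst_eq_inv hQ x
  have block_x := block_eq_pair_of_isTransversal hQ hx hy hy1
  have inv_mem : (x * y)⁻¹ ∈ A.block (x * y) := by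
    simp [block_eq_pair_of_restrictZ3 hK (t := x * y) (by simp [hy1])]
  suffices (x * y)⁻¹ = x * y by
    rw [IsInvPair, block_x, eq_inv_of_mul_eq_one_right (eq_one_of_inv_eq this)]
  have mul_self_eq_one {a : Z} (h : a * a = 1) : a = 1 :=
    inv_eq_self.1 (mul_eq_one_iff_inv_eq.1 h)
  obtain ⟨p, hp, q, hq, hpq⟩ := block_mul_subset x y inv_mem
  have fst_mul : p.1 * q.1 = 1 := by simpa [hy1] using congrArg Prod.fst hpq
  rw [block_x] at hp
  rw [block_eq hy, block_x] at hq
  obtain hp | hp := hp <;> obtain hq | hq := hq <;> rw [hp, hq] at fst_mul hpq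
  · exact absurd (mul_self_eq_one fst_mul) hx1
  · exact hpq.symm
  · exact hpq.symm.trans (mul_comm y x)
  · exact absurd (hy1.symm.trans (mul_self_eq_one fst_mul)) (inv_ne_one.2 hx1)

theorem IsTransversal.exists_isInvPair (hQ : A.quotientZ3.IsSymmetric) {x : Z × Z3}
    (hx : A.IsTransversal x) : ∃ w, w.1 = x.1 ∧ A.IsInvPair w := by
  obtain hx1 | hx1 := eq_or_ne x.1 1
  · exact ⟨1, hx1.symm, isInvPair_one⟩
  rcases A.restrictZ3_isDiscrete_or_isSymmetric with hK | hK
  · obtain ⟨y, hy, hy1⟩ := exists_mem_block_fst_eq_inv hQ x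
    obtain ⟨t, rfl⟩ : ∃ t, y = t * x⁻¹ := ⟨y * x, by group⟩
    have ht1 : t.1 = 1 := by simpa using hy1
    have block_t := block_eq_singleton_of_restrictZ3 hK ht1
    -- `{x, t * x⁻¹}` is moved by the thin element `t` to `{t * x, t⁻¹ * x⁻¹}`.
    refine ⟨t * x, by simp [ht1], ?_⟩
    rw [IsInvPair, block_mul_of_mem_thin block_t, block_eq_pair_of_isTransversal hQ hx hy hy1,
      Set.singleton_mul, Set.image_pair, mul_inv, ← mul_assoc, ← inv_eq_mul_self ht1]
  · exact ⟨x, rfl, hx.isInvPair hQ hK hx1⟩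

/-- The first coordinates of the `x` with basic set `{x, x⁻¹}`. -/
def invPairFst (hQ : A.quotientZ3.IsSymmetric) : Subgroup Z where
  carrier := Prod.fst '' {x | A.IsInvPair x}
  one_mem' := ⟨1, isInvPair_one, rfl⟩
  inv_mem' := by
    rintro _ ⟨x, hx, rfl⟩
    exact ⟨x⁻¹, hx.inv, rfl⟩
  mul_mem' := by
    rintro _ _ ⟨x, hx, rfl⟩ ⟨y, hy, rfl⟩
    obtain hx1 | hx1 := eq_or_ne x.1 1
    · exact ⟨y, hy, by simp [hx1]⟩
    obtain hy1 | hy1 := eq_or_ne y.1 1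
    · exact ⟨x, hx, by simp [hy1]⟩
    obtain hxy1 | hxy1 := eq_or_ne (x.1 * y.1) 1
    · exact ⟨1, isInvPair_one, hxy1.symm⟩
    · exact ⟨x * y, hx.mul hQ hy hx1 hy1 hxy1, rfl⟩

theorem exists_isInvPair_isFullOutside (hQ : A.quotientZ3.IsSymmetric) :
    ∃ x, A.IsInvPair x ∧ A.IsFullOutside (Subgroup.zpowers x.1) := by
  obtain ⟨h, hh⟩ := exists_zpowers_eq (invPairFst hQ)
  obtain ⟨x, hx, rfl⟩ : h ∈ invPairFst hQ := hh ▸ Subgroup.mem_zpowers h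
  refine ⟨x, hx, isFullOutside_of_isTransversal fun y hy => ?_⟩
  obtain ⟨w, hw, hwp⟩ := hy.exists_isInvPair hQ
  rw [hh]
  exact ⟨w, hwp, hw⟩

end SchurRing

/-! ### Schur rings over `Z × Z₃` with a small basic set of `z` -/

/-- The generator of the infinite cyclic group. -/
def genZ : Z := Multiplicative.ofAdd 1

theorem exists_zpow_genZ (n : Z) : ∃ k : ℤ, genZ ^ k = n :=
  ⟨n.toAdd, by simp [genZ, ← ofAdd_zsmul]⟩

theorem genZ_ne_one : genZ ≠ 1 := by
  decide

/-- The automorphism `(n, b) ↦ (n, b⁻¹)` of `Z × Z₃`. -/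
def invSnd : MulAut (Z × Z3) := (MulEquiv.refl Z).prodCongr (MulEquiv.inv Z3)

/-- The automorphism `(n, b) ↦ (n⁻¹, b)` of `Z × Z₃`. -/
def invFst : MulAut (Z × Z3) := (MulEquiv.inv Z).prodCongr (MulEquiv.refl Z3)

theorem invSnd_apply (g : Z × Z3) : invSnd g = (g.1, g.2⁻¹) := rfl

theorem invSnd_invSnd (g : Z × Z3) : invSnd (invSnd g) = g := by
  simp [invSnd_apply]

theorem invFst_apply (g : Z × Z3) : invFst g = (g.1⁻¹, g.2) := rfl

namespace SchurRing

variable {F : Type*} [Field F]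

theorem isOrbit_closure_singleton {G : Type*} [Group G] [Group.FG G] {A : SchurRing F G}
    {φ : MulAut G} (hφ : ∀ g, A.block g = {g, φ g}) : A.IsOrbit (Subgroup.closure {φ}) := by
  refine isOrbit_closure (fun _ hψ g => ?_) fun g u hu => ?_
  · rw [Set.mem_singleton_iff.1 hψ, hφ]
    exact .inr rfl
  · obtain rfl | rfl := hφ g ▸ hu
    · exact ⟨1, Subgroup.one_mem _, rfl⟩
    · exact ⟨φ, Subgroup.mem_closure_singleton_self φ, rfl⟩

variable [CharZero F] {B : SchurRing F (Z × Z3)}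

section ThinGenerator

theorem block_of_genZ_mem_thin (hz : (genZ, 1) ∈ B.thin) (g : Z × Z3) :
    B.block g = {(g.1, 1)} * B.block (1, g.2) := by
  obtain ⟨k, hk⟩ := exists_zpow_genZ g.1
  have hg1 : (g.1, (1 : Z3)) ∈ B.thin := by
    simpa [hk] using B.thin.zpow_mem hz k
  rw [← block_mul_of_mem_thin hg1, Prod.mk_mul_mk, mul_one, one_mul]

theorem isDiscrete_or_isOrbit_of_genZ_mem_thin (hz : (genZ, 1) ∈ B.thin) :
    B.IsDiscrete ∨ B.IsOrbit (Subgroup.closure {invSnd}) := by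
  rcases B.restrictZ3_isDiscrete_or_isSymmetric with hK | hK
  · refine .inl (isDiscrete_iff.2 fun g => ?_)
    rw [block_of_genZ_mem_thin hz, block_eq_singleton_of_restrictZ3 hK rfl]
    simp
  · refine .inr (isOrbit_closure_singleton fun g => ?_)
    rw [block_of_genZ_mem_thin hz, block_eq_pair_of_restrictZ3 hK rfl, Set.singleton_mul,
      Set.image_pair]
    simp [invSnd_apply]

end ThinGenerator

section InvPairGenerator

theorem quotientZ3_isSymmetric_of_isInvPair {x : Z × Z3} (hx : B.IsInvPair x) (hx1 : x.1 ≠ 1) :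
    B.quotientZ3.IsSymmetric := by
  refine B.quotientZ3_isDiscrete_or_isSymmetric.resolve_left fun hQ => hx1 ?_
  exact inv_eq_self.1 (fst_eq_of_mem_block hQ (g := x) (u := x⁻¹) (hx ▸ .inr rfl))

theorem IsInvPair.pow {x : Z × Z3} (hx : B.IsInvPair x) (hx1 : x.1 ≠ 1) (n : ℕ) :
    B.IsInvPair (x ^ n) := by
  induction n with
  | zero => simpa using isInvPair_one
  | succ n ih =>
    obtain rfl | hn := eq_or_ne n 0
    · simpa using hx
    have fst_pow_ne {m : ℕ} (hm : m ≠ 0) : (x ^ m).1 ≠ 1 := by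
      rwa [Prod.pow_fst, Ne, pow_eq_one_iff_left hm]
    rw [pow_succ]
    exact ih.mul (quotientZ3_isSymmetric_of_isInvPair hx hx1) hx (fst_pow_ne hn) hx1
      (pow_succ x n ▸ fst_pow_ne n.succ_ne_zero)

theorem isInvPair_mk_one (hz : B.IsInvPair (genZ, 1)) (n : Z) : B.IsInvPair (n, 1) := by
  obtain ⟨k, rfl⟩ := exists_zpow_genZ n
  obtain ⟨m, rfl | rfl⟩ := k.eq_nat_or_neg
  · simpa using hz.pow genZ_ne_one m
  · simpa using (hz.pow genZ_ne_one m).inv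

theorem isOrbit_invFst (hz : B.IsInvPair (genZ, 1)) (hK : B.restrictZ3.IsDiscrete) :
    B.IsOrbit (Subgroup.closure {invFst}) := by
  refine isOrbit_closure_singleton fun g => ?_
  have thin_snd : ((1, g.2) : Z × Z3) ∈ B.thin := block_eq_singleton_of_restrictZ3 hK rfl
  have := block_mul_of_mem_thin thin_snd (g.1, 1)
  rw [isInvPair_mk_one hz, Set.singleton_mul, Set.image_pair] at this
  simpa [invFst_apply] using this

theorem isSymmetric_of_isInvPair (hz : B.IsInvPair (genZ, 1)) (hK : B.restrictZ3.IsSymmetric)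
    {x : Z × Z3} (hx : B.IsInvPair x) (hx1 : x.1 ≠ 1) (hx2 : x.2 ≠ 1) : B.IsSymmetric := by
  have hQ := quotientZ3_isSymmetric_of_isInvPair hz genZ_ne_one
  refine isSymmetric_iff.2 fun g => ?_
  obtain hg1 | hg1 := eq_or_ne g.1 1
  · exact block_eq_pair_of_restrictZ3 hK hg1
  obtain hg2 | hg2 := eq_or_ne g.2 1
  · exact (Prod.ext rfl hg2 : g = (g.1, 1)) ▸ isInvPair_mk_one hz g.1
  have isInvPair_of_snd_eq {y : Z × Z3} (hy : B.IsInvPair y) (hy1 : y.1 ≠ 1) (h : g.2 = y.2) :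
      B.IsInvPair g := by
    obtain h1 | h1 := eq_or_ne g.1 y.1
    · exact Prod.ext h1 h ▸ hy
    have hg : g = y * (y.1⁻¹ * g.1, 1) := Prod.ext (by simp) (by simp [h])
    rw [hg]
    exact hy.mul hQ (isInvPair_mk_one hz _) hy1 (by simpa [inv_mul_eq_one] using h1.symm)
      (by simpa using hg1)
  rcases Z3.eq_or_eq_inv hx2 hg2 with h | h
  · exact isInvPair_of_snd_eq hx hx1 h
  · exact isInvPair_of_snd_eq hx.inv (inv_ne_one.2 hx1) h

theorem snd_eq_or_eq_inv (hz : B.IsInvPair (genZ, 1)) {g u : Z × Z3} (hu : u ∈ B.block g) :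
    u.2 = g.2 ∨ u.2 = g.2⁻¹ := by
  have snd_eq_one {g u : Z × Z3} (hg : g.2 = 1) (hu : u ∈ B.block g) : u.2 = 1 := by
    obtain ⟨n, b⟩ := g
    obtain rfl : b = 1 := hg
    obtain rfl | rfl := isInvPair_mk_one hz n ▸ hu <;> simp
  obtain hg | hg := eq_or_ne g.2 1
  · exact .inl ((snd_eq_one hg hu).trans hg.symm)
  · exact Z3.eq_or_eq_inv hg fun hu2 => hg (snd_eq_one hu2 (mem_block_symm hu))

theorem invSnd_mem_block (hz : B.IsInvPair (genZ, 1)) (hK : B.restrictZ3.IsSymmetric)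
    (not_isInvPair : ∀ x : Z × Z3, x.1 ≠ 1 → x.2 ≠ 1 → ¬B.IsInvPair x) (g : Z × Z3) :
    invSnd g ∈ B.block g := by
  obtain hg2 | hg2 := eq_or_ne g.2 1
  · simpa [invSnd_apply, hg2] using (Prod.ext rfl hg2 : g = (g.1, 1)) ▸ B.mem_block g
  obtain hg1 | hg1 := eq_or_ne g.1 1
  · rw [block_eq_pair_of_restrictZ3 hK hg1]
    exact .inr (Prod.ext (by simp [invSnd_apply, hg1]) rfl)
  have not_isTransversal : ¬B.IsTransversal g := fun hg =>
    not_isInvPair g hg1 hg2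
      (IsTransversal.isInvPair (quotientZ3_isSymmetric_of_isInvPair hz genZ_ne_one) hK hg1 hg)
  rw [IsTransversal] at not_isTransversal
  push Not at not_isTransversal
  obtain ⟨u, hu, hu1, hug⟩ := not_isTransversal
  have hu2 : u.2 = g.2⁻¹ := (snd_eq_or_eq_inv hz hu).resolve_left fun h => hug (Prod.ext hu1 h)
  rwa [(Prod.ext hu1 hu2 : u = invSnd g)] at hu

theorem isOrbit_invSnd_inv (hz : B.IsInvPair (genZ, 1)) (hK : B.restrictZ3.IsSymmetric)
    (not_isInvPair : ∀ x : Z × Z3, x.1 ≠ 1 → x.2 ≠ 1 → ¬B.IsInvPair x) :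
    B.IsOrbit (Subgroup.closure {invSnd, MulEquiv.inv (Z × Z3)}) := by
  have hQ := quotientZ3_isSymmetric_of_isInvPair hz genZ_ne_one
  have invSnd_mem := invSnd_mem_block hz hK not_isInvPair
  have mem_pair {g u : Z × Z3} (h1 : u.1 = g.1) (h2 : u.2 = g.2 ∨ u.2 = g.2⁻¹) :
      u = g ∨ u = invSnd g :=
    h2.imp (Prod.ext h1) (Prod.ext h1)
  have mem_block {g u : Z × Z3} (hu : u ∈ B.block g) :
      (u = g ∨ u = invSnd g) ∨ (u = g⁻¹ ∨ u = invSnd g⁻¹) := by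
    have h2 := snd_eq_or_eq_inv hz hu
    exact (fst_eq_or_eq_inv hQ hu).imp (fun h => mem_pair h h2)
      fun h => mem_pair h (by simpa [or_comm] using h2)
  refine isOrbit_closure ?_ fun g u hu => ?_
  · rintro _ (rfl | rfl) g
    · exact invSnd_mem g
    · obtain ⟨y, hy, hy1⟩ := exists_mem_block_fst_eq_inv hQ g
      obtain rfl | rfl := mem_pair (g := g⁻¹) hy1 (by simpa [or_comm] using snd_eq_or_eq_inv hz hy)
      · exact hy
      · have := invSnd_mem (invSnd g⁻¹)
        rwa [invSnd_invSnd, block_eq hy] at this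
  · obtain (rfl | rfl) | (rfl | rfl) := mem_block hu
    · exact ⟨1, Subgroup.one_mem _, rfl⟩
    · exact ⟨_, Subgroup.subset_closure (.inl rfl), rfl⟩
    · exact ⟨_, Subgroup.subset_closure (.inr rfl), rfl⟩
    · exact ⟨_, Subgroup.mul_mem _ (Subgroup.subset_closure (.inl rfl))
        (Subgroup.subset_closure (.inr rfl)), rfl⟩

theorem isOrbit_or_isSymmetric_of_isInvPair_genZ (hz : B.IsInvPair (genZ, 1)) :
    B.IsOrbit (Subgroup.closure {invFst}) ∨
      B.IsOrbit (Subgroup.closure {invSnd, MulEquiv.inv (Z × Z3)}) ∨ B.IsSymmetric := by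
  rcases B.restrictZ3_isDiscrete_or_isSymmetric with hK | hK
  · exact .inl (isOrbit_invFst hz hK)
  by_cases h : ∃ x : Z × Z3, x.1 ≠ 1 ∧ x.2 ≠ 1 ∧ B.IsInvPair x
  · obtain ⟨x, hx1, hx2, hx⟩ := h
    exact .inr (.inr (isSymmetric_of_isInvPair hz hK hx hx1 hx2))
  · push Not at h
    exact .inr (.inl (isOrbit_invSnd_inv hz hK h))

end InvPairGenerator

end SchurRing

/-! ### The subgroups `⟨h⟩ × Z₃` -/

theorem genA_inv : genA⁻¹ = genA ^ 2 := by
  decide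

theorem Z3.eq_genA_or_eq_genA_sq {c : Z3} (hc : c ≠ 1) : c = genA ∨ c = genA ^ 2 :=
  genA_inv ▸ Z3.eq_or_eq_inv (by decide) hc

theorem closure_invSnd_inv :
    Subgroup.closure {invSnd, MulEquiv.inv (Z × Z3)} = Subgroup.closure {invSnd, invFst} := by
  have inv_eq : (MulEquiv.inv (Z × Z3) : MulAut (Z × Z3)) = invSnd * invFst := rfl
  rw [inv_eq]
  apply le_antisymm <;> rw [Subgroup.closure_le, Set.pair_subset_iff]
  · exact ⟨Subgroup.subset_closure (.inl rfl),
      Subgroup.mul_mem _ (Subgroup.subset_closure (.inl rfl)) (Subgroup.subset_closure (.inr rfl))⟩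
  · refine ⟨Subgroup.subset_closure (.inl rfl), ?_⟩
    simpa using Subgroup.mul_mem (Subgroup.closure {invSnd, invSnd * invFst})
      (Subgroup.inv_mem _ (Subgroup.subset_closure (.inl rfl)))
      (Subgroup.subset_closure (.inr rfl))

/-- The endomorphism of `Z × Z₃` with `z ↦ x` and `a ↦ a`. -/
def shear (x : Z × Z3) : Z × Z3 →* Z × Z3 :=
  (zpowersHom (Z × Z3) x).coprod (MonoidHom.inr Z Z3)

theorem shear_apply (x g : Z × Z3) : shear x g = x ^ g.1.toAdd * (1, g.2) := rfl

theorem shear_genZ (x : Z × Z3) : shear x (genZ, 1) = x := by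
  simp [shear_apply, genZ]

theorem shear_injective {x : Z × Z3} (hx : x.1 ≠ 1) : Function.Injective (shear x) := by
  rw [injective_iff_map_eq_one]
  intro g hg
  rw [shear_apply] at hg
  have zpow_eq_one : x.1 ^ g.1.toAdd = 1 := by simpa using congrArg Prod.fst hg
  have toAdd_eq_zero : g.1.toAdd = 0 := by
    by_contra hne
    exact hx ((IsMulTorsionFree.zpow_eq_one_iff_left hne).1 zpow_eq_one)
  rw [toAdd_eq_zero, zpow_zero, one_mul] at hg
  exact Prod.ext toAdd_eq_zero (Prod.mk_eq_one.1 hg).2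

theorem range_shear (x : Z × Z3) : (shear x).range = timesZ3 (Subgroup.zpowers x.1) := by
  ext g
  constructor
  · rintro ⟨u, rfl⟩
    exact ⟨⟨u.1.toAdd, by simp [shear_apply]⟩, trivial⟩
  · rintro ⟨⟨m, hm⟩, -⟩
    refine ⟨(Multiplicative.ofAdd m, (x.2 ^ m)⁻¹ * g.2), Prod.ext ?_ ?_⟩
    · simpa [shear_apply] using hm
    · simp [shear_apply]

/-- The isomorphism from `Z × Z₃` to `⟨h⟩ × Z₃` with `z ↦ (h, d)` and `a ↦ a`. -/
def shearEquiv {h : Z} (hh : h ≠ 1) (d : Z3) : Z × Z3 ≃* timesZ3 (Subgroup.zpowers h) :=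
  (MonoidHom.ofInjective (shear_injective (x := (h, d)) hh)).trans
    (MulEquiv.subgroupCongr (range_shear (h, d)))

theorem coe_shearEquiv {h : Z} (hh : h ≠ 1) (d : Z3) (g : Z × Z3) :
    (shearEquiv hh d g : Z × Z3) = shear (h, d) g := rfl

theorem isAutWith_congr {h : Z} (hh : h ≠ 1) (d : Z3) {σ : MulAut (Z × Z3)} {x : Z × Z3} {y : Z3}
    (hx : shear (h, d) (σ (genZ, d⁻¹)) = x) (hy : shear (h, d) (σ (1, genA)) = (1, y)) :
    IsAutWith (Subgroup.zpowers h) (MulAut.congr (shearEquiv hh d) σ) h x y := by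
  refine ⟨rfl, fun u hu => ?_, fun u hu => ?_⟩
  · obtain rfl : u = shearEquiv hh d (genZ, d⁻¹) :=
      Subtype.ext (by simp [hu, coe_shearEquiv, shear_apply, genZ])
    simpa [MulAut.congr, coe_shearEquiv] using hx
  · obtain rfl : u = shearEquiv hh d (1, genA) :=
      Subtype.ext (by simp [hu, coe_shearEquiv, shear_apply])
    simpa [MulAut.congr, coe_shearEquiv] using hy

theorem isAutWith_invSnd {h : Z} (hh : h ≠ 1) (d : Z3) :
    IsAutWith (Subgroup.zpowers h) (MulAut.congr (shearEquiv hh d) invSnd) h (h, d⁻¹)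
      (genA ^ 2) :=
  isAutWith_congr hh d (by simp [shear_apply, invSnd_apply, genZ, Z3.mul_self])
    (by simp [shear_apply, invSnd_apply, genA_inv])

theorem isAutWith_invFst {h : Z} (hh : h ≠ 1) (d : Z3) :
    IsAutWith (Subgroup.zpowers h) (MulAut.congr (shearEquiv hh d) invFst) h (h⁻¹, d) genA :=
  isAutWith_congr hh d
    (by simp [shear_apply, invFst_apply, genZ, ← mul_inv, Z3.mul_self])
    (by simp [shear_apply, invFst_apply])

theorem isAutWith_inv (h : Z) :
    IsAutWith (Subgroup.zpowers h) (MulEquiv.inv _) h (h⁻¹, 1) (genA ^ 2) :=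
  ⟨rfl, fun u hu => by simp [hu], fun u hu => by simp [hu, genA_inv]⟩

namespace SchurRing

variable {F : Type*} [Field F]

theorem IsCayleyIso.isOrbitSchurRing {X Y : Type*} [Group X] [Group Y] {e : X ≃* Y}
    {A : SchurRing F X} {B : SchurRing F Y} (he : IsCayleyIso e A B) (hA : A.IsOrbitSchurRing) :
    B.IsOrbitSchurRing :=
  let ⟨_, h⟩ := hA
  ⟨_, he.isOrbit h⟩

theorem IsCayleyIso.isOrbit_closure {X Y : Type*} [Group X] [Group Y] {e : X ≃* Y}
    {A : SchurRing F X} {B : SchurRing F Y} (he : IsCayleyIso e A B) {S : Set (MulAut X)}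
    (hA : A.IsOrbit (Subgroup.closure S)) :
    B.IsOrbit (Subgroup.closure (MulAut.congr e '' S)) :=
  MonoidHom.map_closure (MulAut.congr e).toMonoidHom S ▸ he.isOrbit hA

variable [CharZero F]

/-- The Schur ring induced on the subgroup `H × Z₃` of `Z × Z₃`. -/
abbrev restrictTimesZ3 (A : SchurRing F (Z × Z3)) (H : Subgroup Z) : SchurRing F (timesZ3 H) :=
  A.restrict (timesZ3 H) (isSSet_timesZ3 H)

/-- The Schur ring over `Z × Z₃` that `shear x` identifies with the one induced by `A` on
`⟨x.1⟩ × Z₃`. -/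
def comapShear (A : SchurRing F (Z × Z3)) {x : Z × Z3} (hx : x.1 ≠ 1) : SchurRing F (Z × Z3) :=
  A.comap (shear x) (shear_injective hx) (range_shear x ▸ isSSet_timesZ3 _)

variable {A : SchurRing F (Z × Z3)}

theorem image_shear_block_comapShear {x : Z × Z3} (hx : x.1 ≠ 1) (g : Z × Z3) :
    shear x '' (A.comapShear hx).block g = A.block (shear x g) :=
  image_block_comap (shear_injective hx) _ g

theorem isCayleyIso_shearEquiv {h : Z} (hh : h ≠ 1) (d : Z3) :
    IsCayleyIso (shearEquiv hh d) (A.comapShear (x := (h, d)) hh)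
      (A.restrictTimesZ3 (Subgroup.zpowers h)) := fun g => by
  apply Subtype.val_injective.image_injective
  rw [image_block_restrict, Set.image_image, coe_shearEquiv]
  exact image_shear_block_comapShear (x := (h, d)) hh g

theorem isOrbitSchurRing_of_comapShear {x : Z × Z3} (hx : x.1 ≠ 1)
    (hx_top : Subgroup.zpowers x.1 = ⊤) (hB : (A.comapShear hx).IsOrbitSchurRing) :
    A.IsOrbitSchurRing := by
  have surjective : Function.Surjective (shear x) := by
    rw [← MonoidHom.range_eq_top, range_shear, timesZ3, hx_top, Subgroup.top_prod_top]
  have isCayleyIso : IsCayleyIso (MulEquiv.ofBijective (shear x) ⟨shear_injective hx, surjective⟩)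
      (A.comapShear hx) A :=
    image_shear_block_comapShear hx
  exact isCayleyIso.isOrbitSchurRing hB

theorem genZ_mem_thin_comapShear {x : Z × Z3} (hx : x.1 ≠ 1) (hxA : x ∈ A.thin) :
    (genZ, 1) ∈ (A.comapShear hx).thin := by
  apply (shear_injective hx).image_injective
  rw [image_shear_block_comapShear, Set.image_singleton, shear_genZ]
  exact hxA

theorem isInvPair_genZ_comapShear {x : Z × Z3} (hx : x.1 ≠ 1) (hxA : A.IsInvPair x) :
    (A.comapShear hx).IsInvPair (genZ, 1) := by
  apply (shear_injective hx).image_injective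
  rw [image_shear_block_comapShear, Set.image_pair, map_inv, shear_genZ]
  exact hxA

end SchurRing

/-! ### The classification -/

theorem subZ3_ne_bot : subZ3 ≠ ⊥ := fun h => by
  have genA_mem : ((1, genA) : Z × Z3) ∈ subZ3 := ⟨one_mem ⊥, trivial⟩
  rw [h, Subgroup.mem_bot] at genA_mem
  exact absurd (congrArg Prod.snd genA_mem) (by decide)

theorem subZ3_le_timesZ3 (H : Subgroup Z) : subZ3 ≤ timesZ3 H :=
  Subgroup.prod_mono bot_le le_rfl

theorem timesZ3_ne_top {H : Subgroup Z} (hH : H ≠ ⊤) : timesZ3 H ≠ ⊤ := fun h =>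
  hH (eq_top_iff.2 fun n _ => (h ▸ Subgroup.mem_top (n, 1) : (n, 1) ∈ timesZ3 H).1)

theorem ne_top_of_timesZ3_ne_top {H : Subgroup Z} (hH : timesZ3 H ≠ ⊤) : H ≠ ⊤ := by
  rintro rfl
  exact hH Subgroup.top_prod_top

theorem congr_inv {G G' : Type*} [CommGroup G] [CommGroup G'] (e : G ≃* G') :
    MulAut.congr e (MulEquiv.inv G) = MulEquiv.inv G' := by
  ext g
  simp [MulAut.congr]

namespace SchurRing

variable {F : Type*} [Field F]

/-- Form (i) of the classification: `A` is a wedge product of a discrete or symmetric Schur ring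
over `Z₃` with a discrete or symmetric one over `Z`. -/
def IsWedgeOverZ3 (A : SchurRing F (Z × Z3)) : Prop :=
  ∃ (A₁ : SchurRing F subZ3) (A₂ : SchurRing F ((Z × Z3) ⧸ subZ3)),
    A.IsWedge subZ3 subZ3 A₁ A₂ ∧
      (A₁.IsDiscrete ∨ A₁.IsSymmetric) ∧ (A₂.IsDiscrete ∨ A₂.IsSymmetric)

/-- Form (ii) of the classification: a wedge product over `H × Z₃` in which the automorphisms of
`H × Z₃` involved preserve both factors. -/
def IsStraightWedge (A : SchurRing F (Z × Z3)) : Prop :=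
  ∃ H : Subgroup Z, H ≠ ⊥ ∧ H ≠ ⊤ ∧
    ∃ (h : Z) (α β : MulAut (timesZ3 H)),
      IsAutWith H α h (h, 1) (genA ^ 2) ∧ IsAutWith H β h (h⁻¹, 1) genA ∧
      ∃ (A₁ : SchurRing F (timesZ3 H)) (A₂ : SchurRing F ((Z × Z3) ⧸ subZ3)),
        A.IsWedge subZ3 (timesZ3 H) A₁ A₂ ∧
        ((A₂.IsDiscrete ∧ (A₁.IsDiscrete ∨ A₁.IsOrbit (Subgroup.closure {α}))) ∨
         (A₂.IsSymmetric ∧ (A₁.IsSymmetric ∨ A₁.IsOrbit (Subgroup.closure {β}) ∨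
            A₁.IsOrbit (Subgroup.closure {α, β}))))

/-- Form (iii) of the classification: a wedge product over `K × Z₃` in which some of the
automorphisms of `K × Z₃` involved shear `K` along `Z₃`. -/
def IsTwistedWedge (A : SchurRing F (Z × Z3)) : Prop :=
  ∃ K : Subgroup Z, K ≠ ⊥ ∧ K ≠ ⊤ ∧
    ∃ (k : Z) (c : Z3) (ψ ρ ξ : MulAut (timesZ3 K)),
      (c = genA ∨ c = genA ^ 2) ∧ IsAutWith K ψ k (k, c) (genA ^ 2) ∧
      IsAutWith K ρ k (k⁻¹, c) genA ∧ IsAutWith K ξ k (k⁻¹, 1) (genA ^ 2) ∧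
      ∃ (A₁ : SchurRing F (timesZ3 K)) (A₂ : SchurRing F ((Z × Z3) ⧸ subZ3)),
        A.IsWedge subZ3 (timesZ3 K) A₁ A₂ ∧
        ((A₂.IsDiscrete ∧ A₁.IsOrbit (Subgroup.closure {ψ})) ∨
         (A₂.IsSymmetric ∧ (A₁.IsOrbit (Subgroup.closure {ρ}) ∨
            A₁.IsOrbit (Subgroup.closure {ψ, ξ}))))

variable {A : SchurRing F (Z × Z3)}

theorem isStraightWedge_of_isWedge {h : Z} (hh : h ≠ 1)
    {A₁ : SchurRing F (timesZ3 (Subgroup.zpowers h))}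
    {A₂ : SchurRing F ((Z × Z3) ⧸ subZ3)} (hW : A.IsWedge subZ3 _ A₁ A₂)
    (hA : (A₂.IsDiscrete ∧ (A₁.IsDiscrete ∨
        A₁.IsOrbit (Subgroup.closure {MulAut.congr (shearEquiv hh 1) invSnd}))) ∨
      (A₂.IsSymmetric ∧ (A₁.IsSymmetric ∨
        A₁.IsOrbit (Subgroup.closure {MulAut.congr (shearEquiv hh 1) invFst}) ∨
        A₁.IsOrbit (Subgroup.closure {MulAut.congr (shearEquiv hh 1) invSnd,
          MulAut.congr (shearEquiv hh 1) invFst})))) :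
    A.IsStraightWedge :=
  ⟨_, Subgroup.zpowers_ne_bot.2 hh, ne_top_of_timesZ3_ne_top hW.1.2.2.1, h, _, _,
    inv_one (G := Z3) ▸ isAutWith_invSnd hh 1, isAutWith_invFst hh 1, A₁, A₂, hW, hA⟩

theorem isTwistedWedge_of_isWedge {h : Z} (hh : h ≠ 1)
    {A₁ : SchurRing F (timesZ3 (Subgroup.zpowers h))}
    {A₂ : SchurRing F ((Z × Z3) ⧸ subZ3)} (hW : A.IsWedge subZ3 _ A₁ A₂) {c : Z3} (hc : c ≠ 1)
    (hA : (A₂.IsDiscrete ∧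
        A₁.IsOrbit (Subgroup.closure {MulAut.congr (shearEquiv hh c⁻¹) invSnd})) ∨
      (A₂.IsSymmetric ∧ (A₁.IsOrbit (Subgroup.closure {MulAut.congr (shearEquiv hh c) invFst}) ∨
        A₁.IsOrbit (Subgroup.closure {MulAut.congr (shearEquiv hh c⁻¹) invSnd,
          MulEquiv.inv _})))) :
    A.IsTwistedWedge :=
  have isAutWith := isAutWith_invSnd hh c⁻¹
  ⟨_, Subgroup.zpowers_ne_bot.2 hh, ne_top_of_timesZ3_ne_top hW.1.2.2.1, h, c, _, _, _,
    Z3.eq_genA_or_eq_genA_sq hc, by rwa [inv_inv] at isAutWith, isAutWith_invFst hh c,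
    isAutWith_inv h, A₁, A₂, hW, hA⟩

variable [CharZero F]

theorem isWedge_of_isFullOutside {H : Subgroup Z} (hH : H ≠ ⊤) (hfull : A.IsFullOutside H) :
    A.IsWedge subZ3 (timesZ3 H) (A.restrictTimesZ3 H) A.quotientZ3 :=
  isWedge_restrict_quotient A.isSSet_subZ3 (isSSet_timesZ3 H) subZ3_ne_bot (subZ3_le_timesZ3 H)
    (timesZ3_ne_top hH) fun g hg k hk =>
      hfull g (fun h => hg ⟨h, trivial⟩) _ (by simp [mem_subZ3_iff.1 hk])

theorem isWedgeOverZ3_of_isFullOutside (hfull : A.IsFullOutside ⊥) : A.IsWedgeOverZ3 :=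
  ⟨_, _, isWedge_of_isFullOutside bot_ne_top hfull, A.restrictZ3_isDiscrete_or_isSymmetric,
    A.quotientZ3_isDiscrete_or_isSymmetric⟩

theorem isStraightWedge_or_isTwistedWedge_of_mem_thin {h : Z} (hh : h ≠ 1) {d : Z3}
    (hQ : A.quotientZ3.IsDiscrete) (hx : (h, d) ∈ A.thin)
    (hW : A.IsWedge subZ3 _ (A.restrictTimesZ3 (Subgroup.zpowers h)) A.quotientZ3) :
    A.IsStraightWedge ∨ A.IsTwistedWedge := by
  have iso := isCayleyIso_shearEquiv (A := A) hh d
  rcases isDiscrete_or_isOrbit_of_genZ_mem_thin (genZ_mem_thin_comapShear hh hx) with hB | hB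
  · exact .inl (isStraightWedge_of_isWedge hh hW
      (.inl ⟨hQ, .inl (iso.isDiscrete hB)⟩))
  have isOrbit := Set.image_singleton ▸ iso.isOrbit_closure hB
  obtain rfl | hd := eq_or_ne d 1
  · exact .inl (isStraightWedge_of_isWedge hh hW (.inl ⟨hQ, .inr isOrbit⟩))
  · exact .inr (isTwistedWedge_of_isWedge hh hW (inv_ne_one.2 hd)
      (.inl ⟨hQ, (inv_inv d).symm ▸ isOrbit⟩))

theorem isStraightWedge_or_isTwistedWedge_of_isInvPair {h : Z} (hh : h ≠ 1) {d : Z3}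
    (hQ : A.quotientZ3.IsSymmetric) (hx : A.IsInvPair (h, d))
    (hW : A.IsWedge subZ3 _ (A.restrictTimesZ3 (Subgroup.zpowers h)) A.quotientZ3) :
    A.IsStraightWedge ∨ A.IsTwistedWedge := by
  have iso := isCayleyIso_shearEquiv (A := A) hh d
  rcases isOrbit_or_isSymmetric_of_isInvPair_genZ (isInvPair_genZ_comapShear hh hx) with
    hB | hB | hB
  · have isOrbit := Set.image_singleton ▸ iso.isOrbit_closure hB
    obtain rfl | hd := eq_or_ne d 1
    · exact .inl (isStraightWedge_of_isWedge hh hW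
        (.inr ⟨hQ, .inr (.inl isOrbit)⟩))
    · exact .inr (isTwistedWedge_of_isWedge hh hW hd (.inr ⟨hQ, .inl isOrbit⟩))
  · obtain rfl | hd := eq_or_ne d 1
    · have isOrbit := Set.image_pair .. ▸ iso.isOrbit_closure (closure_invSnd_inv ▸ hB)
      exact .inl (isStraightWedge_of_isWedge hh hW
        (.inr ⟨hQ, .inr (.inr isOrbit)⟩))
    · have isOrbit := congr_inv (shearEquiv hh d) ▸ Set.image_pair .. ▸ iso.isOrbit_closure hB
      exact .inr (isTwistedWedge_of_isWedge hh hW (inv_ne_one.2 hd)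
        (.inr ⟨hQ, .inr ((inv_inv d).symm ▸ isOrbit)⟩))
  · exact .inl (isStraightWedge_of_isWedge hh hW
      (.inr ⟨hQ, .inl (iso.isSymmetric hB)⟩))

theorem isOrbitSchurRing_of_genZ_mem_thin (hz : (genZ, 1) ∈ A.thin) : A.IsOrbitSchurRing :=
  (isDiscrete_or_isOrbit_of_genZ_mem_thin hz).elim IsDiscrete.isOrbitSchurRing fun h => ⟨_, h⟩

theorem isOrbitSchurRing_of_isInvPair_genZ (hz : A.IsInvPair (genZ, 1)) : A.IsOrbitSchurRing := by
  rcases isOrbit_or_isSymmetric_of_isInvPair_genZ hz with h | h | h <;> exact ⟨_, h⟩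

theorem isWedge_or_isOrbitSchurRing (A : SchurRing F (Z × Z3)) :
    A.IsWedgeOverZ3 ∨ A.IsStraightWedge ∨ A.IsTwistedWedge ∨ A.IsOrbitSchurRing := by
  suffices ∃ x : Z × Z3, A.IsFullOutside (Subgroup.zpowers x.1) ∧ ∀ hx : x.1 ≠ 1,
      (A.comapShear hx).IsOrbitSchurRing ∧
        (A.IsWedge subZ3 _ (A.restrictTimesZ3 (Subgroup.zpowers x.1)) A.quotientZ3 →
          A.IsStraightWedge ∨ A.IsTwistedWedge) by
    obtain ⟨x, hfull, hA⟩ := this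
    obtain hx | hx := eq_or_ne x.1 1
    · exact .inl (isWedgeOverZ3_of_isFullOutside (by simpa [hx] using hfull))
    obtain hx_top | hx_top := eq_or_ne (Subgroup.zpowers x.1) ⊤
    · exact .inr (.inr (.inr (isOrbitSchurRing_of_comapShear hx hx_top (hA hx).1)))
    · exact .inr (((hA hx).2 (isWedge_of_isFullOutside hx_top hfull)).imp_right .inl)
  rcases A.quotientZ3_isDiscrete_or_isSymmetric with hQ | hQ
  · obtain ⟨x, hx, hfull⟩ := exists_mem_thin_isFullOutside hQ
    exact ⟨x, hfull, fun hx1 =>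
      ⟨isOrbitSchurRing_of_genZ_mem_thin (genZ_mem_thin_comapShear hx1 hx),
        isStraightWedge_or_isTwistedWedge_of_mem_thin hx1 hQ hx⟩⟩
  · obtain ⟨x, hx, hfull⟩ := exists_isInvPair_isFullOutside hQ
    exact ⟨x, hfull, fun hx1 =>
      ⟨isOrbitSchurRing_of_isInvPair_genZ (isInvPair_genZ_comapShear hx1 hx),
        isStraightWedge_or_isTwistedWedge_of_isInvPair hx1 hQ hx⟩⟩

theorem isOrbitSchurRing_or_isWedgeProduct (A : SchurRing F (Z × Z3)) :
    A.IsOrbitSchurRing ∨ A.IsWedgeProduct := by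
  rcases A.isWedge_or_isOrbitSchurRing with
    ⟨_, _, hA, -⟩ | ⟨_, _, _, _, _, _, _, _, _, _, hA, -⟩ |
      ⟨_, _, _, _, _, _, _, _, _, _, _, _, _, _, hA, -⟩ | hA
  · exact .inr ⟨_, _, hA.1⟩
  · exact .inr ⟨_, _, hA.1⟩
  · exact .inr ⟨_, _, hA.1⟩
  · exact .inl hA

end SchurRing

end

theorem theorem1p1 (F : Type*) [Field F] [CharZero F] :
    (∀ A : SchurRing F (Z × Z3),
      -- (i) wedge products of a Schur ring over `Z₃` with one over `Z = (Z × Z₃) / Z₃`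
      (∃ (A₁ : SchurRing F subZ3) (A₂ : SchurRing F ((Z × Z3) ⧸ subZ3)),
        A.IsWedge subZ3 subZ3 A₁ A₂ ∧
          (A₁.IsDiscrete ∨ A₁.IsSymmetric) ∧ (A₂.IsDiscrete ∨ A₂.IsSymmetric)) ∨
      -- (ii) wedge products over `H × Z₃`
      (∃ H : Subgroup Z, H ≠ ⊥ ∧ H ≠ ⊤ ∧
        ∃ (h : Z) (α β : MulAut (timesZ3 H)),
          IsAutWith H α h (h, 1) (genA ^ 2) ∧ IsAutWith H β h (h⁻¹, 1) genA ∧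
          ∃ (A₁ : SchurRing F (timesZ3 H)) (A₂ : SchurRing F ((Z × Z3) ⧸ subZ3)),
            A.IsWedge subZ3 (timesZ3 H) A₁ A₂ ∧
            ((A₂.IsDiscrete ∧ (A₁.IsDiscrete ∨ A₁.IsOrbit (Subgroup.closure {α}))) ∨
             (A₂.IsSymmetric ∧ (A₁.IsSymmetric ∨ A₁.IsOrbit (Subgroup.closure {β}) ∨
                A₁.IsOrbit (Subgroup.closure {α, β}))))) ∨
      -- (iii) wedge products over `K × Z₃`
      (∃ K : Subgroup Z, K ≠ ⊥ ∧ K ≠ ⊤ ∧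
        ∃ (k : Z) (c : Z3) (ψ ρ ξ : MulAut (timesZ3 K)),
          (c = genA ∨ c = genA ^ 2) ∧ IsAutWith K ψ k (k, c) (genA ^ 2) ∧
          IsAutWith K ρ k (k⁻¹, c) genA ∧ IsAutWith K ξ k (k⁻¹, 1) (genA ^ 2) ∧
          ∃ (A₁ : SchurRing F (timesZ3 K)) (A₂ : SchurRing F ((Z × Z3) ⧸ subZ3)),
            A.IsWedge subZ3 (timesZ3 K) A₁ A₂ ∧
            ((A₂.IsDiscrete ∧ A₁.IsOrbit (Subgroup.closure {ψ})) ∨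
             (A₂.IsSymmetric ∧ (A₁.IsOrbit (Subgroup.closure {ρ}) ∨
                A₁.IsOrbit (Subgroup.closure {ψ, ξ}))))) ∨
      -- (iv) the group ring and the symmetric Schur ring
      (A.IsDiscrete ∨ A.IsSymmetric) ∨
      -- (v) the orbit Schur rings
      A.IsOrbitSchurRing) ∧
    (∀ A : SchurRing F (Z × Z3), A.IsOrbitSchurRing ∨ A.IsWedgeProduct) ∧
    IsTraditionalGroup F (Z × Z3) := by
  have isOrbit_or_isWedge (A : SchurRing F (Z × Z3)) := A.isOrbitSchurRing_or_isWedgeProduct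
  refine ⟨fun A => ?_, isOrbit_or_isWedge, fun A => ?_⟩
  · exact A.isWedge_or_isOrbitSchurRing.imp_right (.imp_right (.imp_right .inr))
  · exact .inr ((isOrbit_or_isWedge A).imp_right .inr)
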